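/- All graphs are finite, undirected and simple. $K_m$ is the complete graph on $m$ vertices, $tK_1$ is the graph with $t$ vertices and no edges, $\cup$ is the disjoint union, and $G_1\vee G_2$ is obtained from $G_1\cup G_2$ by adding all edges between $V(G_1)$ and $V(G_2)$. A graph is $k$-connected if it has more than $k$ vertices and it stays connected after the deletion of any set of fewer than $k$ vertices. For a connected graph $G$, let $D(G)$ be its distance matrix, let $Tr(G)$ be the diagonal matrix whose entry at $v$ is the sum of the distances from $v$ to all vertices, and let $\eta_1(G)$ be the largest eigenvalue of the distance signless Laplacian matrix $Q_D(G)=D(G)+Tr(G)$. For an odd integer $b\ge 1$, a $[1,b]$-odd factor of a graph is a spanning subgraph in which every vertex has degree in $\{1,3,\dots,b\}$. For an integer $k\ge1$, a graph $G$ of order at least $k+2$ is $k$-critical with respect to $[1,b]$-odd factors if $G-X$ contains a $[1,b]$-odd factor for every $X\subseteq V(G)$ with $|X|=k$. **Theorem 1.6.** Let $b$, $k$ and $n$ be positive integers with $n\equiv k\pmod 2$, $b\equiv 1\pmod 2$ and $b\ge k$, and let $G$ be a $(k+1)$-connected graph of order $n$ with minimum degree $\delta$, where $$n\ \ge\ \max\Big\{(2b^2+4b)\delta^2+2\delta+2b^2k^2,\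 \ \tfrac65 b^2\delta^3+\tfrac85 b^2k\delta^2\Big\}.$$ If $$\eta_1(G)\ \le\ \eta_1\big(K_\delta\vee(K_{n-(b+1)\delta+bk-1}\cup(b\delta-bk+1)K_1)\big),$$ then $G$ is $k$-critical with respect to $[1,b]$-odd factors, unless $$G\cong K_\delta\vee(K_{n-(b+1)\delta+bk-1}\cup(b\delta-bk+1)K_1).$$ -/

import Mathlib

/-- `G` is `k`-connected: it has more than `k` vertices, and deleting fewer than `k` vertices always
leaves a connected graph. -/
def IsKConnected {V : Type*} [Fintype V] (G : SimpleGraph V) (k : ℕ) : Prop :=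
  k < Fintype.card V ∧
    ∀ X : Finset V, X.card < k → (G.induce {v : V | v ∉ X}).Connected

open Classical in
/-- `G` contains a `[1,b]`-odd factor: a spanning subgraph `H` with all degrees in `{1, 3, …, b}`,
where `b` is odd. -/
def HasOddFactor {V : Type*} [Fintype V] (G : SimpleGraph V) (b : ℕ) : Prop :=
  Odd b ∧ ∃ H : SimpleGraph V, H ≤ G ∧ ∀ v : V, Odd (H.degree v) ∧ H.degree v ≤ b

open Classical in
/-- `G`, of order at least `k + 2`, is `k`-critical with respect to `[1,b]`-odd factors: `G - X`
contains a `[1,b]`-odd factor for every set `X` of exactly `k` vertices. -/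
def IsKCriticalOddFactor {V : Type*} [Fintype V] (G : SimpleGraph V) (k b : ℕ) : Prop :=
  k + 2 ≤ Fintype.card V ∧
    ∀ X : Finset V, X.card = k → HasOddFactor (G.induce {v : V | v ∉ X}) b

/-- The transmission of a vertex: the sum of its distances to all vertices. -/
noncomputable def transmission {V : Type*} [Fintype V] (G : SimpleGraph V) (v : V) : ℝ :=
  ∑ w : V, (G.dist v w : ℝ)

/-- The distance matrix. -/
noncomputable def distMatrix {V : Type*} (G : SimpleGraph V) : Matrix V V ℝ :=
  Matrix.of fun u v => (G.dist u v : ℝ)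

/-- The distance signless Laplacian matrix: the distance matrix plus the diagonal matrix of vertex
transmissions. -/
noncomputable def distSignlessLaplacian {V : Type*} [Fintype V] [DecidableEq V]
    (G : SimpleGraph V) : Matrix V V ℝ :=
  distMatrix G + Matrix.diagonal (transmission G)

/-- The distance signless Laplacian spectral radius `η₁(G)`: the largest eigenvalue of the distance
signless Laplacian matrix. The supremum is attained, see `isGreatest_distSignlessRadius`. -/
noncomputable def distSignlessRadius {V : Type*} [Fintype V] [DecidableEq V]
    (G : SimpleGraph V) : ℝ :=
  sSup {x : ℝ | Module.End.HasEigenvalue (Matrix.toLin' (distSignlessLaplacian G)) x}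

theorem isHermitian_distSignlessLaplacian {V : Type*} [Fintype V] [DecidableEq V]
    (G : SimpleGraph V) : (distSignlessLaplacian G).IsHermitian := by
  refine Matrix.IsHermitian.add ?_ ?_
  · ext u v
    simp [distMatrix, SimpleGraph.dist_comm]
  · exact Matrix.isHermitian_diagonal _

theorem isGreatest_distSignlessRadius {V : Type*} [Fintype V] [DecidableEq V] [Nonempty V]
    (G : SimpleGraph V) :
    IsGreatest {x : ℝ | Module.End.HasEigenvalue (Matrix.toLin' (distSignlessLaplacian G)) x}
      (distSignlessRadius G) := by
  have hfin : {x : ℝ |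
      Module.End.HasEigenvalue (Matrix.toLin' (distSignlessLaplacian G)) x}.Finite := by
    simp only [Module.End.hasEigenvalue_iff_mem_spectrum, Set.ofPred_mem_eq]
    exact Module.End.finite_spectrum _
  have hne : {x : ℝ |
      Module.End.HasEigenvalue (Matrix.toLin' (distSignlessLaplacian G)) x}.Nonempty := by
    refine ⟨(isHermitian_distSignlessLaplacian G).eigenvalues (Classical.arbitrary V), ?_⟩
    simp only [Module.End.hasEigenvalue_iff_mem_spectrum, Set.mem_ofPred_eq, Matrix.spectrum_toLin']
    exact (isHermitian_distSignlessLaplacian G).eigenvalues_mem_spectrum_real _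
  exact ⟨hne.csSup_mem hfin, fun x hx => le_csSup hfin.bddAbove hx⟩

/-- The join `G ∨ H`: the disjoint union together with all edges between the two sides. -/
def graphJoin {V W : Type*} (G : SimpleGraph V) (H : SimpleGraph W) : SimpleGraph (V ⊕ W) :=
  (G ⊕g H) ⊔ completeBipartiteGraph V W

/-- The graph `K_s ∨ (K_m ∪ t K₁)`. -/
def joinCliqueIndep (s m t : ℕ) : SimpleGraph (Fin s ⊕ (Fin m ⊕ Fin t)) :=
  graphJoin (SimpleGraph.completeGraph (Fin s))
    (SimpleGraph.completeGraph (Fin m) ⊕g SimpleGraph.emptyGraph (Fin t))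

/-- The graph `K_δ ∨ (K_{n-(b+1)δ+bk-1} ∪ (bδ-bk+1) K₁)`. The subtractions do not truncate when
`k ≤ δ` and `(b+1)δ + 1 ≤ n + bk`. -/
def extremalGraph (n b k δ : ℕ) :
    SimpleGraph (Fin δ ⊕ (Fin (n + b * k - (b + 1) * δ - 1) ⊕ Fin (b * δ - b * k + 1))) :=
  joinCliqueIndep δ (n + b * k - (b + 1) * δ - 1) (b * δ - b * k + 1)

/-!
Suppose that `G` is not `k`-critical. Tutte's theorem for the clone graph of some `G - X` yields a
separator `S` with more than `k` vertices such that `G - S` falls apart into at least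
`b(|S| - k) + 2` pieces. Let `(a, 1, r)` be the Perron vector of the extremal graph
`K_d ∨ (K_m ∪ p K₁)`, where `d = δ`, and place these values on the vertices of `G`: the value `a` on
`d` vertices that contain `S` or are contained in it, the value `r` on `p` vertices spread evenly
over all pieces but the largest one, and `1` elsewhere. Distances in `G` are at least `1`, and at
least `2` between different pieces, so Rayleigh's principle bounds `η₁(G)` from below by a quadratic
form that exceeds the one of the extremal graph by an explicit sum over pairs of vertices.

If `|S| < δ`, every piece has more than `δ - |S|` vertices, and the pairs of vertices of value `1`
in different pieces make the excess positive, a contradiction. If `|S| ≥ δ`, the vector that is `1`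
on `S` and `2` elsewhere first shows `7(|S| - δ) ≤ m`; given this, the excess is positive unless
`|S| = δ`, all pieces but one are single vertices and all edges not excluded by the separation are
present, which describes the extremal graph.
-/

open Finset

section Separation

/-- Deleting `S` from `G` leaves pieces, indexed by `ι`, with no edges between them: `f v` is the
piece of a vertex `v ∉ S`, while the values of `f` on `S` are irrelevant. Every piece is nonempty
but may be a union of several components of `G - S`. -/
structure IsSeparation {V ι : Type*} (G : SimpleGraph V) (S : Finset V) (f : V → ι) : Prop where
  eq_of_adj : ∀ ⦃u v⦄, u ∉ S → v ∉ S → G.Adj u v → f u = f v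
  exists_mem : ∀ i, ∃ v, v ∉ S ∧ f v = i

theorem eq_of_connected_of_forall_adj {V α : Type*} {G : SimpleGraph V} (hG : G.Connected)
    {f : V → α} (hf : ∀ u v, G.Adj u v → f u = f v) (u v : V) : f u = f v := by
  obtain ⟨p⟩ := hG.preconnected u v
  induction p with
  | nil => rfl
  | cons h _ ih => exact (hf _ _ h).trans ih

theorem IsKConnected.connected {V : Type*} [Fintype V] {G : SimpleGraph V} {k : ℕ}
    (hG : IsKConnected G (k + 1)) : G.Connected := by
  have h := hG.2 ∅ (by simp)
  rw [show {v : V | v ∉ (∅ : Finset V)} = Set.univ by simp] at h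
  exact (SimpleGraph.induceUnivIso G).connected_iff.1 h

theorem IsSeparation.le_card_of_isKConnected {V ι : Type*} [Fintype V] [Nontrivial ι]
    {G : SimpleGraph V} {S : Finset V} {f : V → ι} {k : ℕ} (hS : IsSeparation G S f)
    (hG : IsKConnected G k) : k ≤ #S := by
  by_contra! hlt
  obtain ⟨i, j, hij⟩ := exists_pair_ne ι
  obtain ⟨u, hu, rfl⟩ := hS.exists_mem i
  obtain ⟨v, hv, rfl⟩ := hS.exists_mem j
  exact hij (eq_of_connected_of_forall_adj (hG.2 S hlt) (f := fun w => f w)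
    (fun x y h => hS.eq_of_adj x.2 y.2 h) ⟨u, hu⟩ ⟨v, hv⟩)

theorem isSeparation_neighborFinset {V : Type*} [Fintype V] {G : SimpleGraph V}
    [DecidableRel G.Adj] [DecidableEq V] {v w : V} (hvw : v ≠ w) (h : ¬ G.Adj v w) :
    IsSeparation G (G.neighborFinset v) (fun x => decide (x = v)) where
  eq_of_adj x y hx hy hxy := by
    rw [SimpleGraph.mem_neighborFinset] at hx hy
    have hxv : x ≠ v := fun e => hy (e ▸ hxy)
    have hyv : y ≠ v := fun e => hx (e ▸ hxy.symm)
    simp [hxv, hyv]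
  exists_mem i := by
    cases i
    · exact ⟨w, by simpa using h, by simpa using hvw.symm⟩
    · exact ⟨v, by simp, by simp⟩

theorem IsKConnected.lt_minDegree {V : Type*} [Fintype V] {G : SimpleGraph V}
    [DecidableRel G.Adj] {k : ℕ} (hG : IsKConnected G (k + 1)) : k < G.minDegree := by
  classical
  have : Nonempty V := hG.connected.nonempty
  obtain ⟨v, hv⟩ := G.exists_minimal_degree_vertex
  rw [hv]
  by_cases h : ∃ w, v ≠ w ∧ ¬ G.Adj v w
  · obtain ⟨w, hvw, hadj⟩ := h
    exact (isSeparation_neighborFinset hvw hadj).le_card_of_isKConnected hG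
  · push Not at h
    have huniv : univ.erase v ⊆ G.neighborFinset v := fun w hw =>
      (G.mem_neighborFinset v w).2 (h w (ne_of_mem_erase hw).symm)
    have hle := card_le_card huniv
    rw [card_erase_of_mem (mem_univ v), card_univ, SimpleGraph.card_neighborFinset_eq_degree] at hle
    have := hG.1
    omega

theorem exists_isSeparation_connectedComponents {V : Type*} [Finite V] (G : SimpleGraph V)
    (S : Finset V) [Nonempty ((⊤ : G.Subgraph).deleteVerts S).coe.ConnectedComponent] :
    ∃ f : V → Fin (Nat.card ((⊤ : G.Subgraph).deleteVerts S).coe.ConnectedComponent),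
      IsSeparation G S f := by
  classical
  set K := ((⊤ : G.Subgraph).deleteVerts S).coe with hK
  have hmem : ∀ v, v ∉ S → v ∈ ((⊤ : G.Subgraph).deleteVerts S).verts := fun v hv => by simp [hv]
  let e := Finite.equivFin K.ConnectedComponent
  let f : V → Fin (Nat.card K.ConnectedComponent) := fun v =>
    if hv : v ∉ S then e (K.connectedComponentMk ⟨v, hmem v hv⟩) else e (Classical.arbitrary _)
  refine ⟨f, fun u v hu hv huv => ?_, fun i => ?_⟩
  · have hadj : K.Adj ⟨u, hmem u hu⟩ ⟨v, hmem v hv⟩ := by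
      rw [hK, SimpleGraph.Subgraph.coe_adj, SimpleGraph.Subgraph.deleteVerts_adj]
      exact ⟨trivial, hu, trivial, hv, huv⟩
    simp only [f, dif_pos hu, dif_pos hv,
      SimpleGraph.ConnectedComponent.sound hadj.reachable]
  · obtain ⟨⟨v, hv⟩, hvi⟩ := (e.symm i).exists_rep
    have hvS : v ∉ S := by simpa using hv
    refine ⟨v, hvS, ?_⟩
    rw [← e.apply_symm_apply i, ← hvi]
    exact dif_pos hvS

/-- Tutte's theorem, improved by parity: the number of odd components has the parity of `|T|`. -/
theorem exists_isSeparation_of_no_perfectMatching {V : Type*} [Fintype V] (G : SimpleGraph V)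
    (hV : Even (Fintype.card V)) (hG : ∀ M : G.Subgraph, ¬ M.IsPerfectMatching) :
    ∃ (T : Finset V) (N : ℕ) (g : V → Fin N), IsSeparation G T g ∧ #T + 2 ≤ N := by
  classical
  obtain ⟨T, hT⟩ : ∃ T : Set V, G.IsTutteViolator T := by
    by_contra! h
    exact (SimpleGraph.tutte.2 h).elim hG
  lift T to Finset V using T.toFinite
  rw [SimpleGraph.IsTutteViolator, Set.ncard_coe_finset] at hT
  set K := ((⊤ : G.Subgraph).deleteVerts T).coe
  have hcard : Nat.card ((⊤ : G.Subgraph).deleteVerts T).verts + #T = Fintype.card V := by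
    have hverts : ((⊤ : G.Subgraph).deleteVerts T).verts = (T : Set V)ᶜ := by
      simp [Set.compl_eq_univ_sdiff]
    rw [hverts, Nat.card_coe_set_eq, ← Set.ncard_coe_finset T, add_comm,
      Set.ncard_add_ncard_compl, Nat.card_eq_fintype_card]
  have hodd : K.oddComponents.ncard ≤ Nat.card K.ConnectedComponent :=
    Set.ncard_univ K.ConnectedComponent ▸ Set.ncard_le_ncard (Set.subset_univ _) (Set.toFinite _)
  have hparity : Odd K.oddComponents.ncard ↔ Odd #T := by
    rw [SimpleGraph.odd_ncard_oddComponents]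
    rw [← hcard, Nat.even_add'] at hV
    exact hV
  have hN : #T + 2 ≤ Nat.card K.ConnectedComponent := by
    simp only [Nat.odd_iff] at hparity
    omega
  have : Nonempty K.ConnectedComponent := (Nat.card_pos_iff.1 (by omega)).1
  obtain ⟨g, hg⟩ := exists_isSeparation_connectedComponents G T
  exact ⟨T, _, g, hg, hN⟩

end Separation

section CloneGraph

variable {W : Type*} {H : SimpleGraph W} {b : ℕ}

/-- The clone graph of `H`, the lexicographic product of `H` with `K_b`: every vertex is replaced by
a clique of `b` clones. Its perfect matchings encode the `[1,b]`-odd factors of `H`. -/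
def cloneGraph (H : SimpleGraph W) (b : ℕ) : SimpleGraph (W × Fin b) where
  Adj x y := H.Adj x.1 y.1 ∨ x.1 = y.1 ∧ x.2 ≠ y.2
  symm := ⟨fun _ _ h => h.imp .symm (And.imp .symm .symm)⟩
  loopless := ⟨fun _ h => h.elim (H.loopless.irrefl _) fun h => h.2 rfl⟩

/-- The number of clones of `u` that the pairing `φ` of the clones sends to a clone of `v`. -/
def crossings [DecidableEq W] (φ : W × Fin b → W × Fin b) (u v : W) : ℕ :=
  #{i | (φ (u, i)).1 = v}

section Crossings

variable [DecidableEq W] {φ : W × Fin b → W × Fin b}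

theorem sum_crossings [Fintype W] (φ : W × Fin b → W × Fin b) (u : W) :
    ∑ v, crossings φ u v = b := by
  simpa [crossings] using (card_eq_sum_card_fiberwise (f := fun i : Fin b => (φ (u, i)).1)
    (s := univ) (t := univ) fun _ _ => by simp).symm

theorem crossings_comm (hφ : φ.Involutive) (u v : W) : crossings φ u v = crossings φ v u := by
  have hswap : ∀ u v i, (φ (u, i)).1 = v → φ (v, (φ (u, i)).2) = (u, i) := by
    rintro u _ i rfl
    exact hφ (u, i)
  refine card_bij' (fun i _ => (φ (u, i)).2) (fun i _ => (φ (v, i)).2) ?_ ?_ ?_ ?_ <;>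
    · intro i hi
      simp only [mem_filter_univ] at hi ⊢
      rw [hswap _ _ _ hi]

theorem even_crossings_self (hφ : φ.Involutive) (hne : ∀ x, φ x ≠ x) (u : W) :
    Even (crossings φ u u) := by
  have hpair : ∀ i, (φ (u, i)).1 = u → φ (u, i) = (u, (φ (u, i)).2) := fun i hi => Prod.ext hi rfl
  have hsum : ∑ _i ∈ ({i | (φ (u, i)).1 = u} : Finset (Fin b)), (1 : ZMod 2) = 0 := by
    refine sum_involution (fun i _ => (φ (u, i)).2) (fun _ _ => by decide) ?_ ?_ ?_ <;>
      intro i hi <;> simp only [mem_filter_univ] at hi ⊢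
    · exact fun _ h => hne (u, i) ((hpair i hi).trans (by rw [h]))
    · rw [← hpair i hi, hφ]
    · rw [← hpair i hi, hφ]
  rw [crossings, ← ZMod.natCast_eq_zero_iff_even]
  simpa using hsum

theorem adj_of_crossings_ne_zero (hφ : ∀ x, (cloneGraph H b).Adj x (φ x)) {u v : W} (huv : u ≠ v)
    (h : crossings φ u v ≠ 0) : H.Adj u v := by
  obtain ⟨i, hi⟩ := card_ne_zero.1 h
  obtain rfl := (mem_filter_univ i).1 hi
  exact (hφ (u, i)).resolve_right fun h => huv h.1

end Crossings

/-- The factor keeps the edges that carry an odd number of matching edges. -/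
theorem hasOddFactor_of_isPerfectMatching [Fintype W] (hb : Odd b)
    {M : (cloneGraph H b).Subgraph} (hM : M.IsPerfectMatching) : HasOddFactor H b := by
  classical
  choose φ hφ hφu using SimpleGraph.Subgraph.isPerfectMatching_iff.1 hM
  have hinv : φ.Involutive := fun x => (hφu (φ x) x (hφ x).symm).symm
  have hne : ∀ x, φ x ≠ x := fun x h => M.loopless.irrefl x (by simpa [h] using hφ x)
  let K : SimpleGraph W :=
    { Adj := fun u v => u ≠ v ∧ Odd (crossings φ u v)
      symm := ⟨fun u v h => ⟨h.1.symm, crossings_comm hinv u v ▸ h.2⟩⟩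
      loopless := ⟨fun _ h => h.1 rfl⟩ }
  refine ⟨hb, K, fun u v h => ?_, fun u => ?_⟩
  · exact adj_of_crossings_ne_zero (fun x => M.adj_sub (hφ x)) h.1 h.2.pos.ne'
  have hdegree (_ : Fintype (K.neighborSet u)) :
      K.degree u = #{v ∈ univ.erase u | Odd (crossings φ u v)} := by
    rw [← SimpleGraph.card_neighborFinset_eq_degree]
    congr 1
    ext v
    simp [K, eq_comm]
  have hsum : crossings φ u u + ∑ v ∈ univ.erase u, crossings φ u v = b :=
    (add_sum_erase _ _ (mem_univ u)).trans (sum_crossings φ u)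
  rw [hdegree]
  constructor
  · rw [← odd_sum_iff_odd_card_odd]
    rw [← hsum] at hb
    exact (Nat.odd_add'.1 hb).2 (even_crossings_self hinv hne u)
  · calc #{v ∈ univ.erase u | Odd (crossings φ u v)}
        ≤ ∑ v ∈ univ.erase u with Odd (crossings φ u v), crossings φ u v := by
          rw [card_eq_sum_ones]
          exact sum_le_sum fun v hv => (mem_filter.1 hv).2.pos
      _ ≤ ∑ v ∈ univ.erase u, crossings φ u v := sum_le_sum_of_subset (filter_subset _ _)
      _ ≤ b := by omega

/-- A vertex is separated when all of its clones are; the surviving clones of any other vertex lie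
in one piece. -/
theorem IsSeparation.exists_of_cloneGraph [Finite W] {ι : Type*} {T : Finset (W × Fin b)}
    {g : W × Fin b → ι} (hT : IsSeparation (cloneGraph H b) T g) (hb : 0 < b) :
    ∃ (S : Finset W) (f : W → ι), IsSeparation H S f ∧ b * #S ≤ #T := by
  classical
  have := Fintype.ofFinite W
  let S : Finset W := {v | ∀ i, (v, i) ∈ T}
  have hclone : ∀ v, ∃ i, v ∉ S → (v, i) ∉ T := fun v => by
    by_cases hv : v ∈ S
    · exact ⟨⟨0, hb⟩, fun h => (h hv).elim⟩
    · obtain ⟨i, hi⟩ := not_forall.1 fun h => hv ((mem_filter_univ v).2 h)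
      exact ⟨i, fun _ => hi⟩
  choose c hc using hclone
  refine ⟨S, fun v => g (v, c v), ⟨fun u v hu hv huv => ?_, fun i => ?_⟩, ?_⟩
  · exact hT.eq_of_adj (hc u hu) (hc v hv) (Or.inl huv)
  · obtain ⟨⟨v, j⟩, hvT, rfl⟩ := hT.exists_mem i
    have hv : v ∉ S := fun hv => hvT ((mem_filter_univ v).1 hv j)
    refine ⟨v, hv, ?_⟩
    by_cases hj : c v = j
    · simp only [hj]
    · exact hT.eq_of_adj (hc v hv) hvT (Or.inr ⟨rfl, hj⟩)
  · have hsub : S ×ˢ (univ : Finset (Fin b)) ⊆ T := fun x hx =>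
      (mem_filter_univ x.1).1 (mem_product.1 hx).1 x.2
    simpa [mul_comm] using card_le_card hsub

theorem exists_isSeparation_of_not_hasOddFactor [Fintype W] (hb : Odd b)
    (hW : Even (Fintype.card W)) (hH : ¬ HasOddFactor H b) :
    ∃ (S : Finset W) (N : ℕ) (f : W → Fin N), IsSeparation H S f ∧ b * #S + 2 ≤ N := by
  obtain ⟨T, N, g, hT, hN⟩ := exists_isSeparation_of_no_perfectMatching (cloneGraph H b)
    (by simpa using hW.mul_right b) fun M hM => hH (hasOddFactor_of_isPerfectMatching hb hM)
  obtain ⟨S, f, hS, hST⟩ := hT.exists_of_cloneGraph hb.pos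
  exact ⟨S, N, f, hS, by omega⟩

end CloneGraph

section Critical

variable {V ι : Type*} {G : SimpleGraph V}

theorem IsSeparation.of_induce [DecidableEq V] [Nonempty ι] {X : Finset V}
    {S : Finset {v : V | v ∉ X}} {g : {v : V | v ∉ X} → ι}
    (hS : IsSeparation (G.induce {v : V | v ∉ X}) S g) :
    ∃ f : V → ι, IsSeparation G (X ∪ S.map (.subtype _)) f := by
  have hmem : ∀ v (hv : v ∉ X), v ∉ X ∪ S.map (.subtype _) ↔ ⟨v, hv⟩ ∉ S := by simp +contextual
  have hX : ∀ v, v ∉ X ∪ S.map (.subtype _) → v ∉ X := fun v hv => by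
    simp only [mem_union, not_or] at hv
    exact hv.1
  refine ⟨fun v => if hv : v ∉ X then g ⟨v, hv⟩ else Classical.arbitrary ι,
    fun u v hu hv huv => ?_, fun i => ?_⟩
  · rw [dif_pos (hX u hu), dif_pos (hX v hv)]
    exact hS.eq_of_adj ((hmem u (hX u hu)).1 hu) ((hmem v (hX v hv)).1 hv) huv
  · obtain ⟨⟨v, hv⟩, hvS, hvi⟩ := hS.exists_mem i
    exact ⟨v, (hmem v hv).2 hvS, (dif_pos hv).trans hvi⟩

theorem exists_isSeparation_of_not_isKCriticalOddFactor [Fintype V] {b k : ℕ} (hb : Odd b)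
    (hV : Fintype.card V ≡ k [MOD 2]) (hconn : IsKConnected G (k + 1))
    (hG : ¬ IsKCriticalOddFactor G k b) :
    ∃ (S : Finset V) (N : ℕ) (f : V → Fin N),
      IsSeparation G S f ∧ k < #S ∧ b * (#S - k) + 2 ≤ N := by
  classical
  obtain ⟨X, rfl, hX⟩ : ∃ X : Finset V, #X = k ∧ ¬ HasOddFactor (G.induce {v | v ∉ X}) b := by
    by_contra! h
    exact hG ⟨hconn.1, h⟩
  have hcard : Fintype.card {v : V | v ∉ X} + #X = Fintype.card V := by
    rw [← card_compl_add_card X]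
    congr 1
    exact Fintype.card_of_subtype _ (by simp)
  have heven : Even (Fintype.card {v : V | v ∉ X}) := by
    rw [← hcard] at hV
    rw [Nat.ModEq] at hV
    rw [Nat.even_iff]
    omega
  obtain ⟨S, N, g, hS, hN⟩ := exists_isSeparation_of_not_hasOddFactor hb heven hX
  have : Nontrivial (Fin N) := Fin.nontrivial_iff_two_le.2 (by omega)
  obtain ⟨f, hf⟩ := hS.of_induce
  have hdisj : Disjoint X (S.map (.subtype _)) := by
    rw [disjoint_left]
    rintro v hv hvS
    obtain ⟨w, -, rfl⟩ := mem_map.1 hvS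
    exact w.2 hv
  refine ⟨_, N, f, hf, hf.le_card_of_isKConnected hconn, ?_⟩
  rwa [card_union_of_disjoint hdisj, card_map, Nat.add_sub_cancel_left]

end Critical

section Rayleigh

open scoped Matrix

variable {V : Type*} [Fintype V] [DecidableEq V] (G : SimpleGraph V)

theorem distSignlessLaplacian_mulVec_apply (x : V → ℝ) (u : V) :
    (distSignlessLaplacian G *ᵥ x) u = ∑ v, (G.dist u v : ℝ) * (x u + x v) := by
  rw [distSignlessLaplacian, Matrix.add_mulVec, Pi.add_apply, Matrix.mulVec_diagonal,
    Matrix.mulVec, dotProduct, transmission, sum_mul, ← sum_add_distrib]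
  refine sum_congr rfl fun v _ => ?_
  simp only [distMatrix, Matrix.of_apply]
  ring

theorem dotProduct_distSignlessLaplacian_mulVec (x : V → ℝ) :
    2 * (x ⬝ᵥ distSignlessLaplacian G *ᵥ x) = ∑ u, ∑ v, (G.dist u v : ℝ) * (x u + x v) ^ 2 := by
  have hrow : x ⬝ᵥ distSignlessLaplacian G *ᵥ x =
      ∑ u, ∑ v, (G.dist u v : ℝ) * (x u * (x u + x v)) := by
    simp only [dotProduct, distSignlessLaplacian_mulVec_apply, mul_sum, mul_left_comm]
  have hcol : x ⬝ᵥ distSignlessLaplacian G *ᵥ x =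
      ∑ u, ∑ v, (G.dist u v : ℝ) * (x v * (x u + x v)) := by
    rw [hrow, sum_comm]
    simp only [G.dist_comm, add_comm]
  rw [two_mul]
  nth_rw 1 [hrow]
  rw [hcol, ← sum_add_distrib]
  refine sum_congr rfl fun u _ => ?_
  rw [← sum_add_distrib]
  exact sum_congr rfl fun v _ => by ring

open scoped MatrixOrder in
theorem posSemidef_distSignlessRadius_sub [Nonempty V] :
    (distSignlessRadius G • (1 : Matrix V V ℝ) - distSignlessLaplacian G).PosSemidef := by
  have hle : distSignlessLaplacian G ≤ algebraMap ℝ (Matrix V V ℝ) (distSignlessRadius G) := by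
    refine le_algebraMap_of_spectrum_le (fun c hc => ?_)
      (isHermitian_distSignlessLaplacian G).isSelfAdjoint
    rw [← Matrix.spectrum_toLin', ← Module.End.hasEigenvalue_iff_mem_spectrum] at hc
    exact (isGreatest_distSignlessRadius G).2 hc
  rwa [Matrix.le_iff, Algebra.algebraMap_eq_smul_one] at hle

theorem dotProduct_distSignlessRadius_sub (x : V → ℝ) :
    2 * (x ⬝ᵥ (distSignlessRadius G • (1 : Matrix V V ℝ) - distSignlessLaplacian G) *ᵥ x) =
      2 * (distSignlessRadius G * ∑ v, x v ^ 2) -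
        ∑ u, ∑ v, (G.dist u v : ℝ) * (x u + x v) ^ 2 := by
  rw [Matrix.sub_mulVec, Matrix.smul_mulVec, Matrix.one_mulVec, dotProduct_sub, mul_sub,
    dotProduct_distSignlessLaplacian_mulVec, dotProduct_smul, smul_eq_mul]
  simp only [dotProduct, sq]

theorem sum_dist_mul_add_sq_le [Nonempty V] (x : V → ℝ) :
    ∑ u, ∑ v, (G.dist u v : ℝ) * (x u + x v) ^ 2 ≤ 2 * (distSignlessRadius G * ∑ v, x v ^ 2) := by
  have h := (posSemidef_distSignlessRadius_sub G).dotProduct_mulVec_nonneg x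
  rw [star_trivial] at h
  linarith [dotProduct_distSignlessRadius_sub G x]

/-- Passing to absolute values does not decrease the quadratic form of an eigenvector. -/
theorem exists_nonneg_eigenvector [Nonempty V] :
    ∃ w : V → ℝ, 0 ≤ w ∧ w ≠ 0 ∧ distSignlessLaplacian G *ᵥ w = distSignlessRadius G • w := by
  obtain ⟨z, hz⟩ := (isGreatest_distSignlessRadius G).1.exists_hasEigenvector
  have hsub : ∀ {w : V → ℝ},
      (distSignlessRadius G • (1 : Matrix V V ℝ) - distSignlessLaplacian G) *ᵥ w = 0 ↔
        distSignlessLaplacian G *ᵥ w = distSignlessRadius G • w := fun {w} => by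
    rw [Matrix.sub_mulVec, Matrix.smul_mulVec, Matrix.one_mulVec, sub_eq_zero, eq_comm]
  have hz_eq : 2 * (distSignlessRadius G * ∑ v, z v ^ 2) =
      ∑ u, ∑ v, (G.dist u v : ℝ) * (z u + z v) ^ 2 := by
    have h := dotProduct_distSignlessRadius_sub G z
    rw [hsub.2 (by simpa using hz.apply_eq_smul), dotProduct_zero] at h
    linarith
  have hle : ∑ u, ∑ v, (G.dist u v : ℝ) * (z u + z v) ^ 2 ≤
      ∑ u, ∑ v, (G.dist u v : ℝ) * (|z u| + |z v|) ^ 2 := by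
    gcongr 2 with u _ v _
    rw [← sq_abs (z u + z v)]
    gcongr
    exact abs_add_le _ _
  refine ⟨fun v => |z v|, fun v => abs_nonneg _, fun h => hz.2 (funext fun v => ?_), ?_⟩
  · exact abs_eq_zero.1 (congrFun h v)
  · have hpsd := posSemidef_distSignlessRadius_sub G
    rw [← hsub, ← hpsd.dotProduct_mulVec_zero_iff]
    refine le_antisymm ?_ (hpsd.dotProduct_mulVec_nonneg _)
    have h := dotProduct_distSignlessRadius_sub G fun v => |z v|
    simp only [sq_abs] at h
    rw [star_trivial]
    linarith

/-- Half of the sum of `(x u + x v) ^ 2` over the ordered pairs of elements of `B`, see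
`sum_product_add_sq`. -/
def pairForm {V : Type*} (B : Finset V) (x : V → ℝ) : ℝ :=
  #B * ∑ v ∈ B, x v ^ 2 + (∑ v ∈ B, x v) ^ 2

theorem sum_product_add_sq {V : Type*} (B : Finset V) (x : V → ℝ) :
    ∑ e ∈ B ×ˢ B, (x e.1 + x e.2) ^ 2 = 2 * pairForm B x := by
  simp only [sum_product, add_sq, sum_add_distrib, sum_const, nsmul_eq_mul, ← mul_sum, ← sum_mul,
    pairForm]
  ring

theorem pairForm_of_forall_eq {V : Type*} {B : Finset V} {x : V → ℝ} {c : ℝ}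
    (hx : ∀ v ∈ B, x v = c) : pairForm B x = 2 * c ^ 2 * #B ^ 2 := by
  rw [pairForm, sum_congr rfl hx, sum_congr rfl fun v hv => congrArg (· ^ 2) (hx v hv), sum_const,
    sum_const, nsmul_eq_mul, nsmul_eq_mul]
  ring

/-- The ordered pairs of distinct nonadjacent vertices. -/
def nonadjPairs [DecidableRel G.Adj] : Finset (V × V) :=
  {e | e.1 ≠ e.2 ∧ ¬ G.Adj e.1 e.2}

/-- Distances are at least `1`, and at least `2` between nonadjacent vertices. -/
theorem rayleigh_nonadjPairs {G : SimpleGraph V} [DecidableRel G.Adj] (hG : G.Connected)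
    (x : V → ℝ) :
    2 * (pairForm univ x - 2 * ∑ v, x v ^ 2) + ∑ e ∈ nonadjPairs G, (x e.1 + x e.2) ^ 2 ≤
      2 * (distSignlessRadius G * ∑ v, x v ^ 2) := by
  have := hG.nonempty
  have hdist : ∀ u v, (1 - if u = v then 1 else 0) + (if u ≠ v ∧ ¬ G.Adj u v then 1 else 0) ≤
      (G.dist u v : ℝ) := fun u v => by
    by_cases huv : u = v
    · simp [huv]
    · have hpos := hG.pos_dist_of_ne huv
      by_cases hadj : G.Adj u v
      · simp [huv, hadj, SimpleGraph.dist_eq_one_iff_adj.2 hadj]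
      · have hne := mt SimpleGraph.dist_eq_one_iff_adj.1 hadj
        have htwo : (2 : ℝ) ≤ G.dist u v := by exact_mod_cast (by omega : 2 ≤ G.dist u v)
        simpa [huv, hadj, one_add_one_eq_two] using htwo
  calc 2 * (pairForm univ x - 2 * ∑ v, x v ^ 2) + ∑ e ∈ nonadjPairs G, (x e.1 + x e.2) ^ 2
      = ∑ u, ∑ v, ((1 - if u = v then 1 else 0) + if u ≠ v ∧ ¬ G.Adj u v then 1 else 0) *
          (x u + x v) ^ 2 := by
        rw [mul_sub, ← sum_product_add_sq, univ_product_univ, nonadjPairs, sum_filter,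
          Fintype.sum_prod_type, Fintype.sum_prod_type]
        simp only [add_mul, sub_mul, one_mul, ite_mul, zero_mul, sum_add_distrib, sum_sub_distrib,
          sum_ite_eq, mem_univ, if_true, ← two_mul, mul_pow, ← mul_sum]
        ring
    _ ≤ ∑ u, ∑ v, (G.dist u v : ℝ) * (x u + x v) ^ 2 :=
        sum_le_sum fun u _ => sum_le_sum fun v _ =>
          mul_le_mul_of_nonneg_right (hdist u v) (sq_nonneg _)
    _ ≤ 2 * (distSignlessRadius G * ∑ v, x v ^ 2) := sum_dist_mul_add_sq_le G x

end Rayleigh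

section Pieces

variable {V ι : Type*} [Fintype V] [DecidableEq V] [DecidableEq ι]
  {G : SimpleGraph V} {S : Finset V} {f : V → ι}

/-- The piece of `G - S` indexed by `i`. -/
def piece (S : Finset V) (f : V → ι) (i : ι) : Finset V := {v ∈ Sᶜ | f v = i}

@[simp]
theorem mem_piece {i : ι} {v : V} : v ∈ piece S f i ↔ v ∉ S ∧ f v = i := by
  simp [piece]

theorem IsSeparation.piece_nonempty (hS : IsSeparation G S f) (i : ι) : (piece S f i).Nonempty :=
  (hS.exists_mem i).imp fun _ => mem_piece.2

theorem sum_card_piece [Fintype ι] (S : Finset V) (f : V → ι) : ∑ i, #(piece S f i) = #Sᶜ :=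
  (card_eq_sum_card_fiberwise (by simp)).symm

/-- The ordered pairs of vertices outside `S` lying in different pieces. -/
def separatedPairs (S : Finset V) (f : V → ι) : Finset (V × V) :=
  {e ∈ Sᶜ ×ˢ Sᶜ | f e.1 ≠ f e.2}

theorem IsSeparation.separatedPairs_subset [DecidableRel G.Adj] (hS : IsSeparation G S f) :
    separatedPairs S f ⊆ nonadjPairs G := fun e he => by
  simp only [separatedPairs, mem_filter, mem_product, mem_compl] at he
  exact (mem_filter_univ e).2
    ⟨fun h => he.2 (congrArg f h), fun h => he.2 (hS.eq_of_adj he.1.1 he.1.2 h)⟩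

/-- Half of the sum of `(x u + x v) ^ 2` over the ordered pairs separated by `S`, see
`sum_separatedPairs`. -/
def sepForm [Fintype ι] (S : Finset V) (f : V → ι) (x : V → ℝ) : ℝ :=
  pairForm Sᶜ x - ∑ i, pairForm (piece S f i) x

theorem sum_separatedPairs [Fintype ι] (S : Finset V) (f : V → ι) (x : V → ℝ) :
    ∑ e ∈ separatedPairs S f, (x e.1 + x e.2) ^ 2 = 2 * sepForm S f x := by
  have hpieces : ∑ e ∈ Sᶜ ×ˢ Sᶜ with f e.1 = f e.2, (x e.1 + x e.2) ^ 2 =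
      2 * ∑ i, pairForm (piece S f i) x := by
    rw [mul_sum, ← sum_fiberwise (g := fun e : V × V => f e.1)]
    refine sum_congr rfl fun i _ => ?_
    rw [← sum_product_add_sq]
    congr 1
    ext e
    simp only [mem_filter, mem_product, mem_compl, mem_piece]
    constructor
    · rintro ⟨⟨⟨h₁, h₂⟩, h⟩, rfl⟩
      exact ⟨⟨h₁, rfl⟩, h₂, h.symm⟩
    · rintro ⟨⟨h₁, rfl⟩, h₂, h⟩
      exact ⟨⟨⟨h₁, h₂⟩, h.symm⟩, rfl⟩
  rw [sepForm, mul_sub, ← sum_product_add_sq, ← hpieces, separatedPairs,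
    ← sum_filter_add_sum_filter_not (Sᶜ ×ˢ Sᶜ) (fun e => f e.1 = f e.2), add_sub_cancel_left]

variable [Fintype ι]

theorem IsSeparation.rayleigh (hS : IsSeparation G S f) (hG : G.Connected) (x : V → ℝ) :
    pairForm univ x - 2 * ∑ v, x v ^ 2 + sepForm S f x ≤
      distSignlessRadius G * ∑ v, x v ^ 2 := by
  classical
  have hsum := sum_le_sum_of_subset_of_nonneg hS.separatedPairs_subset
    (f := fun e => (x e.1 + x e.2) ^ 2) fun e _ _ => sq_nonneg _
  rw [sum_separatedPairs] at hsum
  linarith [rayleigh_nonadjPairs hG x]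

theorem IsSeparation.adj_of_le_rayleigh (hS : IsSeparation G S f) (hG : G.Connected) {x : V → ℝ}
    (hx : ∀ v, 0 < x v)
    (hle : distSignlessRadius G * ∑ v, x v ^ 2 ≤
      pairForm univ x - 2 * ∑ v, x v ^ 2 + sepForm S f x)
    {u v : V} (huv : u ≠ v) (h : u ∈ S ∨ v ∈ S ∨ f u = f v) : G.Adj u v := by
  classical
  by_contra hadj
  have hsum := sum_lt_sum_of_subset hS.separatedPairs_subset (i := (u, v))
    (f := fun e => (x e.1 + x e.2) ^ 2) ((mem_filter_univ _).2 ⟨huv, hadj⟩)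
    (fun he => by
      simp only [separatedPairs, mem_filter, mem_product, mem_compl] at he
      tauto)
    (pow_pos (add_pos (hx u) (hx v)) 2) fun e _ _ => sq_nonneg _
  rw [sum_separatedPairs] at hsum
  linarith [rayleigh_nonadjPairs hG x]

end Pieces

section JoinCliqueIndep

open scoped Matrix

variable {s m t : ℕ}

theorem joinCliqueIndep_adj_inl (i : Fin s) (x : Fin s ⊕ (Fin m ⊕ Fin t)) :
    (joinCliqueIndep s m t).Adj (.inl i) x ↔ x ≠ .inl i := by
  rcases x with j | x <;> simp [joinCliqueIndep, graphJoin, eq_comm]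

theorem joinCliqueIndep_adj_inr (x y : Fin m ⊕ Fin t) :
    (joinCliqueIndep s m t).Adj (.inr x) (.inr y) ↔ x ≠ y ∧ x.isLeft ∧ y.isLeft := by
  rcases x with i | i <;> rcases y with j | j <;> simp [joinCliqueIndep, graphJoin]

theorem dist_joinCliqueIndep_inl (i : Fin s) (x : Fin s ⊕ (Fin m ⊕ Fin t)) :
    ((joinCliqueIndep s m t).dist (.inl i) x : ℝ) = 1 - if x = .inl i then 1 else 0 := by
  by_cases h : x = .inl i
  · simp [h]
  · simp [h, SimpleGraph.dist_eq_one_iff_adj.2 ((joinCliqueIndep_adj_inl i x).2 h)]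

theorem dist_eq_two_of_adj {V : Type*} {G : SimpleGraph V} {u v w : V} (huv : u ≠ v)
    (hadj : ¬ G.Adj u v) (huw : G.Adj u w) (hwv : G.Adj w v) : G.dist u v = 2 := by
  have hle : G.dist u v ≤ 2 := SimpleGraph.dist_le (.cons huw (.cons hwv .nil))
  have hpos := (huw.reachable.trans hwv.reachable).pos_dist_of_ne huv
  have hne := mt SimpleGraph.dist_eq_one_iff_adj.1 hadj
  omega

theorem dist_joinCliqueIndep_inr (hs : 0 < s) (x y : Fin m ⊕ Fin t) :
    ((joinCliqueIndep s m t).dist (.inr x) (.inr y) : ℝ) =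
      (if x.isLeft ∧ y.isLeft then 1 else 2) *
        (1 - if y = x then 1 else 0) := by
  by_cases hxy : y = x
  · simp [hxy]
  by_cases hleft : x.isLeft ∧ y.isLeft
  · rw [SimpleGraph.dist_eq_one_iff_adj.2
      ((joinCliqueIndep_adj_inr x y).2 ⟨Ne.symm hxy, hleft⟩)]
    simp [hxy, hleft]
  · rw [dist_eq_two_of_adj (w := .inl ⟨0, hs⟩) (by simpa using Ne.symm hxy)
      (fun h => hleft ((joinCliqueIndep_adj_inr x y).1 h).2)
      ((joinCliqueIndep_adj_inl _ _).2 (by simp)).symm ((joinCliqueIndep_adj_inl _ _).2 (by simp))]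
    simp [hxy, hleft]

section Rows

variable (w : Fin s ⊕ (Fin m ⊕ Fin t) → ℝ)

theorem mulVec_joinCliqueIndep_inl (i : Fin s) :
    (distSignlessLaplacian (joinCliqueIndep s m t) *ᵥ w) (.inl i) =
      (s + m + t - 2) * w (.inl i) + ∑ x, w x := by
  simp only [distSignlessLaplacian_mulVec_apply, dist_joinCliqueIndep_inl, sub_mul, one_mul,
    ite_mul, zero_mul, sum_sub_distrib, sum_add_distrib, sum_const, card_univ, Fintype.card_sum,
    Fintype.card_fin, nsmul_eq_mul, sum_ite_eq', mem_univ, if_true]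
  push_cast
  ring

theorem mulVec_joinCliqueIndep_inr_inl (hs : 0 < s) (i : Fin m) :
    (distSignlessLaplacian (joinCliqueIndep s m t) *ᵥ w) (.inr (.inl i)) =
      (s + m + t - 2 + t) * w (.inr (.inl i)) + ∑ x, w x + ∑ j, w (.inr (.inr j)) := by
  simp only [distSignlessLaplacian_mulVec_apply, Fintype.sum_sum_type,
    (joinCliqueIndep s m t).dist_comm (u := .inr _) (v := .inl _), dist_joinCliqueIndep_inl,
    dist_joinCliqueIndep_inr hs, sub_mul, mul_sub, one_mul, mul_one, ite_mul, zero_mul, mul_ite,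
    mul_zero, sum_sub_distrib, sum_add_distrib, sum_const, card_univ, Fintype.card_fin,
    nsmul_eq_mul, sum_ite_eq', mem_univ, if_true, if_false, reduceCtorEq, ← mul_sum,
    Sum.isLeft_inl, Sum.isLeft_inr, and_self, and_false, Bool.false_eq_true]
  ring

theorem mulVec_joinCliqueIndep_inr_inr (hs : 0 < s) (i : Fin t) :
    (distSignlessLaplacian (joinCliqueIndep s m t) *ᵥ w) (.inr (.inr i)) =
      (s + m + t - 2 + (m + t - 2)) * w (.inr (.inr i)) + ∑ x, w x +
        (∑ j, w (.inr (.inl j)) + ∑ j, w (.inr (.inr j))) := by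
  simp only [distSignlessLaplacian_mulVec_apply, Fintype.sum_sum_type,
    (joinCliqueIndep s m t).dist_comm (u := .inr _) (v := .inl _), dist_joinCliqueIndep_inl,
    dist_joinCliqueIndep_inr hs, sub_mul, mul_sub, one_mul, mul_one, ite_mul, zero_mul, mul_ite,
    mul_zero, sum_sub_distrib, sum_add_distrib, sum_const, card_univ, Fintype.card_fin,
    nsmul_eq_mul, sum_ite_eq', mem_univ, if_true, if_false, reduceCtorEq, ← mul_sum,
    Sum.isLeft_inr, false_and, Bool.false_eq_true, Fintype.card_sum, Nat.cast_add]
  ring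

end Rows

/-- The entries `a`, `1` and `r` of the Perron vector of `K_d ∨ (K_m ∪ p K₁)` on the three parts,
for the eigenvalue `y`; the three equations are the rows of the eigenvalue equation. -/
structure IsPerronTriple (d m p a r y : ℝ) : Prop where
  d_pos : 0 < d
  one_le_m : 1 ≤ m
  p_pos : 0 < p
  a_pos : 0 < a
  r_pos : 0 < r
  eq_a : (y - (d + m + p) + 2) * a = d * a + m + p * r
  eq_one : y - (d + m + p) - p + 2 = d * a + m + p * r + p * r
  eq_r : (y - (d + m + p) - m - p + 4) * r = d * a + m + p * r + m + p * r

theorem exists_pos_forall_eq_of_mul_eq {α : Type*} [Nonempty α] {w : α → ℝ} {c B : ℝ}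
    (hw : ∀ i, 0 ≤ w i) (hB : 0 < B) (h : ∀ i, c * w i = B) : ∃ z, 0 < z ∧ ∀ i, w i = z := by
  have hc : c ≠ 0 := fun hc => by
    have := h (Classical.arbitrary α)
    rw [hc, zero_mul] at this
    exact hB.ne this
  have heq : ∀ i, w i = B / c := fun i => by rw [← h i, mul_div_cancel_left₀ _ hc]
  refine ⟨B / c, lt_of_le_of_ne ?_ (div_ne_zero hB.ne' hc).symm, heq⟩
  exact heq (Classical.arbitrary α) ▸ hw _

theorem exists_isPerronTriple (hs : 0 < s) (hm : 0 < m) (ht : 0 < t) :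
    ∃ a r, IsPerronTriple s m t a r (distSignlessRadius (joinCliqueIndep s m t)) := by
  have : NeZero s := ⟨hs.ne'⟩
  have : NeZero m := ⟨hm.ne'⟩
  have : NeZero t := ⟨ht.ne'⟩
  obtain ⟨w, hw_nonneg, hw_ne, hw⟩ := exists_nonneg_eigenvector (joinCliqueIndep s m t)
  set y := distSignlessRadius (joinCliqueIndep s m t)
  have hrow := fun x => congrFun hw x
  simp only [Pi.smul_apply, smul_eq_mul] at hrow
  have hsum : 0 < ∑ x, w x := by
    obtain ⟨x, hx⟩ := Function.ne_iff.1 hw_ne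
    exact sum_pos' (fun x _ => hw_nonneg x) ⟨x, mem_univ x, (hw_nonneg x).lt_of_ne' hx⟩
  have hsum_clique : 0 ≤ ∑ j, w (.inr (.inl j)) := sum_nonneg fun j _ => hw_nonneg _
  have hsum_indep : 0 ≤ ∑ j, w (.inr (.inr j)) := sum_nonneg fun j _ => hw_nonneg _
  obtain ⟨α, hα, hwα⟩ := exists_pos_forall_eq_of_mul_eq (fun i => hw_nonneg (.inl i)) hsum
    (c := y - (s + m + t) + 2) fun i => by
      linarith [hrow (.inl i), mulVec_joinCliqueIndep_inl w i]
  obtain ⟨β, hβ, hwβ⟩ := exists_pos_forall_eq_of_mul_eq (fun i => hw_nonneg (.inr (.inl i)))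
    (add_pos_of_pos_of_nonneg hsum hsum_indep) (c := y - (s + m + t) - t + 2) fun i => by
      linarith [hrow (.inr (.inl i)), mulVec_joinCliqueIndep_inr_inl w hs i]
  obtain ⟨γ, hγ, hwγ⟩ := exists_pos_forall_eq_of_mul_eq (fun i => hw_nonneg (.inr (.inr i)))
    (add_pos_of_pos_of_nonneg hsum (add_nonneg hsum_clique hsum_indep))
    (c := y - (s + m + t) - m - t + 4) fun i => by
      linarith [hrow (.inr (.inr i)), mulVec_joinCliqueIndep_inr_inr w hs i]
  have hrow_inl := (mulVec_joinCliqueIndep_inl w 0).symm.trans (hrow _)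
  have hrow_clique := (mulVec_joinCliqueIndep_inr_inl w hs 0).symm.trans (hrow _)
  have hrow_indep := (mulVec_joinCliqueIndep_inr_inr w hs 0).symm.trans (hrow _)
  simp only [Fintype.sum_sum_type, hwα, hwβ, hwγ, sum_const, card_univ, Fintype.card_fin,
    nsmul_eq_mul] at hrow_inl hrow_clique hrow_indep
  refine ⟨α / β, γ / β, by positivity, by exact_mod_cast hm, by positivity, by positivity,
    by positivity, ?_, ?_, ?_⟩
  all_goals
    field_simp
    linarith

end JoinCliqueIndep

/-- Half of the sum of `(x u + x v) ^ 2` over the ordered pairs of nonadjacent vertices of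
`K_d ∨ (K_m ∪ p K₁)`, where `x` is `1` on `K_m` and `r` on `p K₁`. -/
def extremalForm (m p r : ℝ) : ℝ :=
  2 * r ^ 2 * (p ^ 2 - p) + (1 + r) ^ 2 * (p * m)

namespace IsPerronTriple

variable {d m p a r y : ℝ}

theorem rayleigh (h : IsPerronTriple d m p a r y) :
    y * (d * a ^ 2 + p * r ^ 2 + m) =
      (d + p + m - 2) * (d * a ^ 2 + p * r ^ 2 + m) + (d * a + p * r + m) ^ 2 +
        extremalForm m p r := by
  rw [extremalForm]
  linear_combination d * a * h.eq_a + m * h.eq_one + p * r * h.eq_r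

theorem balance_one_r (h : IsPerronTriple d m p a r y) :
    (d * a + 2 * (p * r)) * (r - 1) = 2 * (m - r) := by
  linear_combination h.eq_r - r * h.eq_one

theorem balance_a_one (h : IsPerronTriple d m p a r y) :
    a * (d * a + m + p * r + p * r + p) = d * a + m + p * r := by
  linear_combination h.eq_a - a * h.eq_one

theorem one_le_r (h : IsPerronTriple d m p a r y) : 1 ≤ r := by
  obtain ⟨hd, hm, hp, ha, hr, -, -, -⟩ := id h
  by_contra! hlt
  have hneg : (d * a + 2 * (p * r)) * (r - 1) < 0 :=
    mul_neg_of_pos_of_neg (by positivity) (by linarith)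
  linarith [h.balance_one_r]

theorem quadratic_le (h : IsPerronTriple d m p a r y) : p * (r ^ 2 - r) + r ≤ m := by
  have hnonneg : 0 ≤ d * a * (r - 1) :=
    mul_nonneg (mul_nonneg h.d_pos.le h.a_pos.le) (by linarith [h.one_le_r])
  linarith [h.balance_one_r]

theorem a_le_one (h : IsPerronTriple d m p a r y) : a ≤ 1 := by
  obtain ⟨hd, hm, hp, ha, hr, -, -, -⟩ := id h
  have hpos : 0 < d * a + m + p * r := by positivity
  have hextra : 0 < a * (p * r + p) := by positivity
  refine le_of_mul_le_mul_right ?_ hpos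
  linarith [h.balance_a_one]

theorem y_le (h : IsPerronTriple d m p a r y) : y ≤ 2 * (d + m + p) - 2 + 2 * (p * r) := by
  have hda := mul_le_mul_of_nonneg_left h.a_le_one h.d_pos.le
  linarith [h.eq_one]

theorem mul_r_le (h : IsPerronTriple d m p a r y) : p * r ≤ m / 8 + 81 / 32 * p := by
  have hsq : 0 ≤ p * (2 * r - 9) ^ 2 := mul_nonneg h.p_pos.le (sq_nonneg _)
  linarith [h.quadratic_le, h.r_pos]

theorem mul_one_add_r_sq_le (h : IsPerronTriple d m p a r y) (hpm : 13 * p ≤ m) :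
    p * (1 + r) ^ 2 ≤ 21 / 10 * m := by
  have hsq : 0 ≤ p * (4 * r - 17) ^ 2 := mul_nonneg h.p_pos.le (sq_nonneg _)
  linarith [h.quadratic_le, h.r_pos, h.p_pos]

theorem three_quarters_le_a (h : IsPerronTriple d m p a r y) (hpm : 13 * p ≤ m) : 3 / 4 ≤ a := by
  obtain ⟨hd, hm, hp, ha, hr, -, -, -⟩ := id h
  have hpos : 0 < d * a + m + p * r + p * r + p := by positivity
  have hda : 0 < d * a := by positivity
  refine le_of_mul_le_mul_right ?_ hpos
  linarith [h.balance_a_one, h.mul_r_le]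

/-- The bound `13 * p ≤ m` suffices as long as `r ≤ 15 / 4`; beyond that `m` is bounded below in
terms of `r` by `quadratic_le`. -/
theorem gain_pos (h : IsPerronTriple d m p a r y) (hpm : 13 * p ≤ m) (hp : 3 ≤ p) :
    2 * r ^ 2 * p + (1 + r) ^ 2 * ((p + 1) / 2) < 2 * m + (a + r) ^ 2 * p := by
  have har : (3 / 4 + r) ^ 2 * p ≤ (a + r) ^ 2 * p := by
    have := h.r_pos
    have := h.three_quarters_le_a hpm
    gcongr
  have hr := h.one_le_r
  refine lt_of_lt_of_le ?_ (add_le_add_right har _)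
  rcases le_total r (15 / 4) with hr' | hr'
  · nlinarith [mul_nonneg (sub_nonneg.2 hp) (mul_nonneg (sub_nonneg.2 hr) (sub_nonneg.2 hr')),
      mul_nonneg (sub_nonneg.2 hp) (sub_nonneg.2 hr'),
      mul_nonneg (sub_nonneg.2 hr) (sub_nonneg.2 hr')]
  · nlinarith [h.quadratic_le, mul_nonneg (sub_nonneg.2 hp) (sq_nonneg (r - 15 / 4)),
      mul_nonneg (sub_nonneg.2 hp) (sub_nonneg.2 hr'), sq_nonneg (r - 15 / 4)]

end IsPerronTriple

section ThreeValued

variable {V : Type*} [DecidableEq V] {A I : Finset V} {a r : ℝ}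

/-- The vector with value `a` on `A`, `r` on `I` and `1` elsewhere. -/
def threeValued (A I : Finset V) (a r : ℝ) (v : V) : ℝ :=
  if v ∈ A then a else if v ∈ I then r else 1

theorem threeValued_pos (ha : 0 < a) (hr : 0 < r) (v : V) : 0 < threeValued A I a r v := by
  unfold threeValued
  split_ifs <;> positivity

theorem card_inter_add_card_inter_add_card_sdiff (hAI : Disjoint A I) (B : Finset V) :
    #(B ∩ A) + #(B ∩ I) + #(B \ (A ∪ I)) = #B := by
  rw [← card_union_of_disjoint (hAI.mono inter_subset_right inter_subset_right),
    ← inter_union_distrib_left, card_inter_add_card_sdiff]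

theorem sum_threeValued (hAI : Disjoint A I) (B : Finset V) (g : ℝ → ℝ) :
    ∑ v ∈ B, g (threeValued A I a r v) =
      #(B ∩ A) * g a + #(B ∩ I) * g r + #(B \ (A ∪ I)) * g 1 := by
  have hA : ∑ v ∈ B ∩ A, g (threeValued A I a r v) = #(B ∩ A) * g a := by
    rw [← nsmul_eq_mul]
    exact sum_eq_card_nsmul fun v hv => by simp [threeValued, (mem_inter.1 hv).2]
  have hI : ∑ v ∈ B ∩ I, g (threeValued A I a r v) = #(B ∩ I) * g r := by
    rw [← nsmul_eq_mul]
    exact sum_eq_card_nsmul fun v hv => by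
      simp [threeValued, (mem_inter.1 hv).2, disjoint_right.1 hAI (mem_inter.1 hv).2]
  have hrest : ∑ v ∈ B \ (A ∪ I), g (threeValued A I a r v) = #(B \ (A ∪ I)) * g 1 := by
    rw [← nsmul_eq_mul]
    refine sum_eq_card_nsmul fun v hv => ?_
    simp only [mem_sdiff, mem_union, not_or] at hv
    simp [threeValued, hv.2.1, hv.2.2]
  rw [← sum_inter_add_sum_sdiff B (A ∪ I), inter_union_distrib_left,
    sum_union (hAI.mono inter_subset_right inter_subset_right), hA, hI, hrest]

theorem pairForm_threeValued (hAI : Disjoint A I) (B : Finset V) :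
    pairForm B (threeValued A I a r) =
      2 * (a ^ 2 * #(B ∩ A) ^ 2 + r ^ 2 * #(B ∩ I) ^ 2 + #(B \ (A ∪ I)) ^ 2) +
        (a + r) ^ 2 * (#(B ∩ A) * #(B ∩ I)) + (1 + a) ^ 2 * (#(B ∩ A) * #(B \ (A ∪ I))) +
          (1 + r) ^ 2 * (#(B ∩ I) * #(B \ (A ∪ I))) := by
  rw [pairForm, sum_threeValued hAI B fun z => z, sum_threeValued hAI B fun z => z ^ 2,
    ← card_inter_add_card_inter_add_card_sdiff hAI B]
  push_cast
  ring

theorem IsPerronTriple.rayleigh_threeValued [Fintype V] {d m p y : ℝ}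
    (h : IsPerronTriple d m p a r y) (hAI : Disjoint A I) (hA : #A = d) (hI : #I = p)
    (hV : Fintype.card V = d + p + m) :
    y * ∑ v, threeValued A I a r v ^ 2 =
      pairForm univ (threeValued A I a r) - 2 * ∑ v, threeValued A I a r v ^ 2 +
        extremalForm m p r := by
  have hcard : (#(A ∪ I)ᶜ : ℝ) = m := by
    rw [card_compl, Nat.cast_sub (card_le_univ _), card_union_of_disjoint hAI, Nat.cast_add, hA, hI,
      hV]
    ring
  have hsq := sum_threeValued (a := a) (r := r) hAI univ fun z => z ^ 2
  have hsum := sum_threeValued (a := a) (r := r) hAI univ fun z => z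
  simp only [univ_inter, ← compl_eq_univ_sdiff, hA, hI, hcard, one_pow, mul_one] at hsq hsum
  rw [pairForm, hsq, hsum, h.rayleigh, card_univ, hV]
  ring

end ThreeValued

section SumSq

variable {ι : Type*} [Fintype ι] {x : ι → ℝ}

theorem mul_sum_sub_le_sq_sum_sub_sum_sq (hx : ∀ i, 0 ≤ x i) {q : ι} {t : ℝ}
    (hq : ∀ i, x i ≤ x q + t) :
    (∑ i, x i - x q) * (∑ i, x i - t) ≤ (∑ i, x i) ^ 2 - ∑ i, x i ^ 2 := by
  classical
  have hsq : ∑ i ∈ univ.erase q, x i ^ 2 ≤ (x q + t) * ∑ i ∈ univ.erase q, x i := by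
    rw [mul_sum]
    exact sum_le_sum fun i _ => by
      rw [sq]
      exact mul_le_mul_of_nonneg_right (hq i) (hx i)
  rw [← add_sum_erase univ (fun i => x i ^ 2) (mem_univ q), ← add_sum_erase univ x (mem_univ q)]
  linarith

theorem two_mul_mul_le_sq_sum_sub_sum_sq (hx : ∀ i, 0 ≤ x i) (q : ι) :
    2 * (∑ i, x i - x q) * x q ≤ (∑ i, x i) ^ 2 - ∑ i, x i ^ 2 := by
  classical
  have hsq := sum_sq_le_sq_sum_of_nonneg (s := univ.erase q) (f := x) fun i _ => hx i
  rw [← add_sum_erase univ (fun i => x i ^ 2) (mem_univ q), ← add_sum_erase univ x (mem_univ q)]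
  linarith

end SumSq

section Placement

variable {V ι : Type*} {S A I : Finset V} {f : V → ι} {q : ι}

/-- Vertex sets `A` and `I` that play the roles of `K_d` and of `p K₁` in the extremal graph
`K_d ∨ (K_m ∪ p K₁)`: outside the separator, `A` lies in the piece `q`, while `I` avoids the
separator and that piece. -/
structure IsPlacement (S : Finset V) (f : V → ι) (q : ι) (A I : Finset V) : Prop where
  eq_of_mem : ∀ v ∈ A, v ∉ S → f v = q
  ne_of_mem : ∀ v ∈ I, v ∉ S ∧ f v ≠ q

namespace IsPlacement

theorem disjoint (h : IsPlacement S f q A I) : Disjoint A I :=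
  disjoint_left.2 fun v hvA hvI =>
    (h.ne_of_mem v hvI).2 (h.eq_of_mem v hvA (h.ne_of_mem v hvI).1)

variable [Fintype V] [DecidableEq V]

theorem compl_inter_indep (h : IsPlacement S f q A I) : Sᶜ ∩ I = I :=
  inter_eq_right.2 fun v hv => mem_compl.2 (h.ne_of_mem v hv).1

theorem card_compl_sdiff_add (h : IsPlacement S f q A I) :
    #(Sᶜ \ (A ∪ I)) + #(S \ A) + #A + #I = Fintype.card V := by
  have hsplit := card_inter_add_card_inter_add_card_sdiff h.disjoint Sᶜ
  rw [h.compl_inter_indep, inter_comm Sᶜ A, ← sdiff_eq_inter_compl] at hsplit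
  have hcompl := S.card_add_card_compl
  have hS := card_sdiff_add_card_inter S A
  have hA := card_sdiff_add_card_inter A S
  rw [inter_comm] at hA
  omega

variable [DecidableEq ι]

theorem piece_inter_of_ne (h : IsPlacement S f q A I) {i : ι} (hi : i ≠ q) :
    piece S f i ∩ A = ∅ := by
  ext v
  simp only [mem_inter, mem_piece, notMem_empty, iff_false, not_and]
  rintro ⟨hvS, rfl⟩ hvA
  exact hi (h.eq_of_mem v hvA hvS)

theorem piece_inter_self (h : IsPlacement S f q A I) : piece S f q ∩ A = A \ S := by
  ext v
  simp only [mem_inter, mem_piece, mem_sdiff]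
  exact ⟨fun hv => ⟨hv.2, hv.1.1⟩, fun hv => ⟨⟨hv.2, h.eq_of_mem v hv.1 hv.2⟩, hv.1⟩⟩

theorem piece_inter_indep_self (h : IsPlacement S f q A I) : piece S f q ∩ I = ∅ := by
  ext v
  simp only [mem_inter, mem_piece, notMem_empty, iff_false, not_and]
  exact fun hv hvI => (h.ne_of_mem v hvI).2 hv.2

theorem card_piece_of_ne (h : IsPlacement S f q A I) {i : ι} (hi : i ≠ q) :
    #(piece S f i ∩ I) + #(piece S f i \ (A ∪ I)) = #(piece S f i) := by
  rw [← card_inter_add_card_inter_add_card_sdiff h.disjoint (piece S f i), h.piece_inter_of_ne hi,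
    card_empty, zero_add]

theorem card_piece_self (h : IsPlacement S f q A I) :
    #(A \ S) + #(piece S f q \ (A ∪ I)) = #(piece S f q) := by
  rw [← card_inter_add_card_inter_add_card_sdiff h.disjoint (piece S f q), h.piece_inter_self,
    h.piece_inter_indep_self, card_empty, add_zero]

variable [Fintype ι]

theorem sum_card_piece_inter (h : IsPlacement S f q A I) : ∑ i, #(piece S f i ∩ I) = #I := by
  simp only [piece, filter_inter]
  rw [← card_eq_sum_card_fiberwise fun _ _ => mem_coe.2 (mem_univ _), h.compl_inter_indep]

theorem sum_card_piece_sdiff (S : Finset V) (f : V → ι) (B : Finset V) :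
    ∑ i, #(piece S f i \ B) = #(Sᶜ \ B) := by
  simp only [piece, sdiff_eq_inter_compl, filter_inter]
  exact (card_eq_sum_card_fiberwise (f := f) (t := univ) fun _ _ => mem_coe.2 (mem_univ _)).symm

theorem sum_erase_card_piece (h : IsPlacement S f q A I) :
    ∑ i ∈ univ.erase q, #(piece S f i) + #(piece S f q \ (A ∪ I)) = #I + #(Sᶜ \ (A ∪ I)) := by
  rw [← sum_card_piece_sdiff S f, ← h.sum_card_piece_inter, ← sum_erase_add univ _ (mem_univ q),
    ← sum_erase_add univ (fun i => #(piece S f i \ (A ∪ I))) (mem_univ q),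
    h.piece_inter_indep_self, card_empty, add_zero, ← add_assoc, ← sum_add_distrib]
  exact congrArg (· + _) (sum_congr rfl fun i hi => (h.card_piece_of_ne (ne_of_mem_erase hi)).symm)

theorem sepForm_threeValued (h : IsPlacement S f q A I) (a r : ℝ) :
    sepForm S f (threeValued A I a r) =
      2 * r ^ 2 * (#I ^ 2 - ∑ i, (#(piece S f i ∩ I) : ℝ) ^ 2) +
        2 * (#(Sᶜ \ (A ∪ I)) ^ 2 - ∑ i, (#(piece S f i \ (A ∪ I)) : ℝ) ^ 2) +
        (a + r) ^ 2 * (#(A \ S) * #I) +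
        (1 + a) ^ 2 * (#(A \ S) * (#(Sᶜ \ (A ∪ I)) - #(piece S f q \ (A ∪ I)))) +
        (1 + r) ^ 2 * (#I * #(Sᶜ \ (A ∪ I)) -
          ∑ i, (#(piece S f i ∩ I) : ℝ) * #(piece S f i \ (A ∪ I))) := by
  have hA (i : ι) : (#(piece S f i ∩ A) : ℝ) = if i = q then (#(A \ S) : ℝ) else 0 := by
    split_ifs with hi
    · rw [hi, h.piece_inter_self]
    · rw [h.piece_inter_of_ne hi, card_empty, Nat.cast_zero]
  have hq : (#(piece S f q ∩ I) : ℝ) = 0 := by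
    rw [h.piece_inter_indep_self, card_empty, Nat.cast_zero]
  have hAS : Sᶜ ∩ A = A \ S := by rw [inter_comm, sdiff_eq_inter_compl]
  rw [sepForm, pairForm_threeValued h.disjoint, h.compl_inter_indep, hAS]
  simp only [pairForm_threeValued h.disjoint, hA, sum_add_distrib, ← mul_sum, ite_mul, zero_mul,
    ite_pow, sum_ite_eq', mem_univ, if_true, hq, ne_eq, OfNat.ofNat_ne_zero, not_false_eq_true,
    zero_pow]
  ring

/-- Relative to `K_d ∨ (K_m ∪ p K₁)`, pairs of `I` inside one piece cost the terms in `κ`, and the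
`t` vertices of the separator with value `1` cost the terms in `t`. -/
theorem le_sepForm (h : IsPlacement S f q A I) {κ m t : ℝ}
    (hκ : ∀ i, (#(piece S f i ∩ I) : ℝ) ≤ κ + 1) (hm : #(Sᶜ \ (A ∪ I)) + t = m) (a r : ℝ) :
    extremalForm m #I r +
        2 * (#(Sᶜ \ (A ∪ I)) ^ 2 - ∑ i, (#(piece S f i \ (A ∪ I)) : ℝ) ^ 2) +
        (a + r) ^ 2 * (#(A \ S) * #I) +
        (1 + a) ^ 2 * (#(A \ S) * (#(Sᶜ \ (A ∪ I)) - #(piece S f q \ (A ∪ I)))) -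
        2 * r ^ 2 * (κ * #I) -
        (1 + r) ^ 2 * (#I * t + ∑ i, (#(piece S f i ∩ I) : ℝ) * #(piece S f i \ (A ∪ I))) ≤
      sepForm S f (threeValued A I a r) := by
  have hsq : ∑ i, (#(piece S f i ∩ I) : ℝ) ^ 2 ≤ (κ + 1) * #I := by
    rw [← h.sum_card_piece_inter, Nat.cast_sum, mul_sum]
    exact sum_le_sum fun i _ => by
      rw [sq]
      exact mul_le_mul_of_nonneg_right (hκ i) (Nat.cast_nonneg _)
  have hmul := mul_le_mul_of_nonneg_left hsq (sq_nonneg r)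
  rw [h.sepForm_threeValued, extremalForm, ← hm]
  linarith

theorem mul_le_card_sq_sub_sum_card_sq (h : IsPlacement S f q A I)
    (hq : ∀ i, #(piece S f i) ≤ #(piece S f q)) :
    ((#(Sᶜ \ (A ∪ I)) : ℝ) - #(piece S f q \ (A ∪ I))) * (#(Sᶜ \ (A ∪ I)) - #(A \ S)) ≤
      #(Sᶜ \ (A ∪ I)) ^ 2 - ∑ i, (#(piece S f i \ (A ∪ I)) : ℝ) ^ 2 := by
  rw [← sum_card_piece_sdiff S f, Nat.cast_sum]
  refine mul_sum_sub_le_sq_sum_sub_sum_sq (fun i => Nat.cast_nonneg _) fun i => ?_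
  have := (card_le_card (sdiff_subset (s := piece S f i) (t := A ∪ I))).trans (hq i)
  rw [← h.card_piece_self, add_comm] at this
  exact_mod_cast this

theorem two_mul_mul_le_card_sq_sub_sum_card_sq (S A I : Finset V) (f : V → ι) (q : ι) :
    2 * ((#(Sᶜ \ (A ∪ I)) : ℝ) - #(piece S f q \ (A ∪ I))) * #(piece S f q \ (A ∪ I)) ≤
      #(Sᶜ \ (A ∪ I)) ^ 2 - ∑ i, (#(piece S f i \ (A ∪ I)) : ℝ) ^ 2 := by
  rw [← sum_card_piece_sdiff S f, Nat.cast_sum]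
  exact two_mul_mul_le_sq_sum_sub_sum_sq (fun i => Nat.cast_nonneg _) q

theorem sum_card_mul_card_le (h : IsPlacement S f q A I) {κ : ℝ}
    (hκ : ∀ i, (#(piece S f i ∩ I) : ℝ) ≤ κ) :
    ∑ i, (#(piece S f i ∩ I) : ℝ) * #(piece S f i \ (A ∪ I)) ≤
      κ * (#(Sᶜ \ (A ∪ I)) - #(piece S f q \ (A ∪ I))) := by
  rw [← sum_card_piece_sdiff S f, Nat.cast_sum, ← sum_erase_eq_sub (mem_univ q), mul_sum,
    ← sum_erase univ (a := q)
      (by rw [h.piece_inter_indep_self, card_empty, Nat.cast_zero, zero_mul])]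
  exact sum_le_sum fun i _ => mul_le_mul_of_nonneg_right (hκ i) (Nat.cast_nonneg _)

theorem exists_indep (q : ι) {κ p : ℕ} (hpiece : ∀ i, κ + 1 ≤ #(piece S f i))
    (hp : p ≤ (Fintype.card ι - 1) * (κ + 1)) :
    ∃ I : Finset V, #I = p ∧ (∀ v ∈ I, v ∉ S ∧ f v ≠ q) ∧ ∀ i, #(piece S f i ∩ I) ≤ κ + 1 := by
  choose T hT hcard using fun i => exists_subset_card_eq (hpiece i)
  have hfiber {i : ι} {v : V} (hv : v ∈ T i) : v ∉ S ∧ f v = i := mem_piece.1 (hT i hv)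
  have hU : #((univ.erase q).biUnion T) = (Fintype.card ι - 1) * (κ + 1) := by
    rw [card_biUnion fun i _ j _ hij => disjoint_left.2 fun v hi hj =>
        hij ((hfiber hi).2.symm.trans (hfiber hj).2),
      sum_congr rfl fun i _ => hcard i, sum_const, smul_eq_mul, card_erase_of_mem (mem_univ q),
      card_univ]
  obtain ⟨I, hIU, hI⟩ := exists_subset_card_eq (hp.trans_eq hU.symm)
  refine ⟨I, hI, fun v hv => ?_, fun i => ?_⟩
  · obtain ⟨i, hi, hv⟩ := mem_biUnion.1 (hIU hv)
    exact ⟨(hfiber hv).1, (hfiber hv).2.trans_ne (ne_of_mem_erase hi)⟩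
  · rw [← hcard i]
    refine card_le_card fun v hv => ?_
    obtain ⟨j, -, hj⟩ := mem_biUnion.1 (hIU (mem_inter.1 hv).2)
    rwa [← (mem_piece.1 (mem_inter.1 hv).1).2, (hfiber hj).2]

end IsPlacement
end Placement

section Comparison

variable {V ι : Type*} [Fintype V] [DecidableEq V] [Fintype ι] [DecidableEq ι]
  {G : SimpleGraph V} {S A I : Finset V} {f : V → ι} {q : ι} {d m p : ℕ} {a r y : ℝ}

theorem IsPlacement.sepForm_le_extremalForm (hP : IsPlacement S f q A I)
    (hS : IsSeparation G S f) (hG : G.Connected) (h : IsPerronTriple d m p a r y)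
    (hη : distSignlessRadius G ≤ y) (hV : Fintype.card V = d + m + p) (hA : #A = d)
    (hI : #I = p) : sepForm S f (threeValued A I a r) ≤ extremalForm m p r := by
  have hy := h.rayleigh_threeValued hP.disjoint (by rw [hA]) (by rw [hI])
    (by rw [hV]; push_cast; ring)
  have hle := mul_le_mul_of_nonneg_right hη
    (sum_nonneg fun v (_ : v ∈ univ) => sq_nonneg (threeValued A I a r v))
  linarith [hS.rayleigh hG (threeValued A I a r)]

theorem IsPlacement.adj_of_extremalForm_le (hP : IsPlacement S f q A I)
    (hS : IsSeparation G S f) (hG : G.Connected) (h : IsPerronTriple d m p a r y)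
    (hη : distSignlessRadius G ≤ y) (hV : Fintype.card V = d + m + p) (hA : #A = d)
    (hI : #I = p) (hle : extremalForm m p r ≤ sepForm S f (threeValued A I a r))
    {u v : V} (huv : u ≠ v) (hsep : u ∈ S ∨ v ∈ S ∨ f u = f v) : G.Adj u v := by
  have hy := h.rayleigh_threeValued hP.disjoint (by rw [hA]) (by rw [hI])
    (by rw [hV]; push_cast; ring)
  have hle' := mul_le_mul_of_nonneg_right hη
    (sum_nonneg fun v (_ : v ∈ univ) => sq_nonneg (threeValued A I a r v))
  exact hS.adj_of_le_rayleigh hG (threeValued_pos h.a_pos h.r_pos) (by linarith) huv hsep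

end Comparison

section SmallSeparator

theorem IsPerronTriple.false_of_gain_le {d m p a r y κ t B : ℝ}
    (h : IsPerronTriple d m p a r y) (hpm : 13 * p ≤ m) (hp : 3 ≤ p) (ht : 0 < t) (hκt : κ ≤ t)
    (hκp : 2 * κ + 1 ≤ p) (hB : t ≤ B)
    (hle : 2 * (B * (m - t)) + (a + r) ^ 2 * (t * p) + (1 + a) ^ 2 * (t * B) ≤
      2 * r ^ 2 * (κ * p) + (1 + r) ^ 2 * ((κ + 1) * B)) : False := by
  have hB' : 0 ≤ t * B := by nlinarith
  have hW : (1 + r) ^ 2 * (κ + 1) ≤ (1 + r) ^ 2 * ((p + 1) / 2) := by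
    gcongr
    linarith
  have hWm : (1 + r) ^ 2 * (κ + 1) ≤ 2 * m := by
    nlinarith [h.mul_one_add_r_sq_le hpm, h.one_le_m, sq_nonneg (1 + r)]
  have ha : 2 * (t * B) ≤ (1 + a) ^ 2 * (t * B) := by
    gcongr
    nlinarith [h.three_quarters_le_a hpm]
  have hshrink := mul_le_mul_of_nonneg_left hB (sub_nonneg.2 hWm)
  have hκ : r ^ 2 * (κ * p) ≤ r ^ 2 * (t * p) := by gcongr
  have hgain := mul_lt_mul_of_pos_left (h.gain_pos hpm hp) ht
  have := mul_le_mul_of_nonneg_left hW ht.le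
  linarith

variable {V ι : Type*} [Fintype V] [DecidableEq V] [Fintype ι] [DecidableEq ι]
  {G : SimpleGraph V} {S : Finset V} {f : V → ι} {d m p t : ℕ} {a r y : ℝ}

omit [Fintype ι] in
theorem IsSeparation.minDegree_lt_card_add_card_piece [DecidableRel G.Adj]
    (hS : IsSeparation G S f) (i : ι) : G.minDegree < #S + #(piece S f i) := by
  obtain ⟨v, hv⟩ := hS.piece_nonempty i
  have hsub : G.neighborFinset v ⊆ S ∪ (piece S f i).erase v := fun w hw => by
    have hadj := (G.mem_neighborFinset v w).1 hw
    rw [mem_union, mem_erase, mem_piece, or_iff_not_imp_left]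
    exact fun hwS => ⟨hadj.ne', hwS,
      (hS.eq_of_adj (mem_piece.1 hv).1 hwS hadj).symm.trans (mem_piece.1 hv).2⟩
  have hcard := (card_le_card hsub).trans (card_union_le _ _)
  rw [card_erase_of_mem hv, SimpleGraph.card_neighborFinset_eq_degree] at hcard
  have := card_pos.2 ⟨v, hv⟩
  have := G.minDegree_le_degree v
  omega

omit [Fintype ι] in
theorem IsPlacement.false_of_card_sdiff_pos [Finite ι] {A I : Finset V} {q : ι} {κ : ℕ}
    (hP : IsPlacement S f q A I) (hS : IsSeparation G S f) (hG : G.Connected)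
    (h : IsPerronTriple d m p a r y) (hη : distSignlessRadius G ≤ y)
    (hV : Fintype.card V = d + m + p) (hpm : 13 * p ≤ m) (hp : 3 ≤ p)
    (hq : ∀ i, #(piece S f i) ≤ #(piece S f q)) (hSA : S ⊆ A) (hA : #A = d) (hI : #I = p)
    (ht : 0 < #(A \ S)) (hκ : ∀ i, #(piece S f i ∩ I) ≤ κ + 1) (hκt : κ ≤ #(A \ S))
    (hκp : 2 * κ + 1 ≤ p) (hloose : #(A \ S) + #(piece S f q \ (A ∪ I)) ≤ m) : False := by
  have := Fintype.ofFinite ι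
  have hm : #(Sᶜ \ (A ∪ I)) = m := by
    have := hP.card_compl_sdiff_add
    rw [sdiff_eq_empty_iff_subset.2 hSA, card_empty, hA, hI, hV] at this
    omega
  have hκ' (i : ι) : (#(piece S f i ∩ I) : ℝ) ≤ κ + 1 := mod_cast hκ i
  have hle := hP.sepForm_le_extremalForm hS hG h hη hV hA hI
  have hform := hP.le_sepForm (t := 0) hκ' (by rw [hm, add_zero]) a r
  have hspread := hP.mul_le_card_sq_sub_sum_card_sq hq
  have hcross := mul_le_mul_of_nonneg_left (hP.sum_card_mul_card_le hκ') (sq_nonneg (1 + r))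
  rw [hm, hI] at hform
  rw [hm] at hspread hcross
  have hloose' : (#(A \ S) : ℝ) ≤ m - #(piece S f q \ (A ∪ I)) :=
    le_sub_iff_add_le.2 (mod_cast hloose)
  refine h.false_of_gain_le (mod_cast hpm) (mod_cast hp) (Nat.cast_pos.2 ht) (Nat.cast_le.2 hκt)
    (mod_cast hκp) hloose' ?_
  linarith

theorem IsSeparation.false_of_card_lt [Nonempty ι] (hS : IsSeparation G S f) (hG : G.Connected)
    (h : IsPerronTriple d m p a r y) (hη : distSignlessRadius G ≤ y)
    (hV : Fintype.card V = d + m + p) (hpm : 13 * p ≤ m) (hp : 3 ≤ p) (ht : 0 < t)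
    (hSd : #S + t = d) (hpiece : ∀ i, t + 1 ≤ #(piece S f i)) (hN : 3 ≤ Fintype.card ι)
    (hpt : p + t ≤ (Fintype.card ι - 1) * (t + 1)) : False := by
  set N := Fintype.card ι - 1 with hNdef
  obtain ⟨q, hq⟩ := exists_max_image univ (fun i => #(piece S f i)) univ_nonempty
  obtain ⟨κ, hκt, hκp, hκ⟩ : ∃ κ, κ ≤ t ∧ 2 * κ + 1 ≤ p ∧ p ≤ N * (κ + 1) := by
    have hdiv := Nat.div_mul_le_self (p - 1) N
    have hlt := Nat.lt_div_mul_add (a := p - 1) (by omega : 0 < N)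
    refine ⟨(p - 1) / N, Nat.lt_succ_iff.1 ((Nat.div_lt_iff_lt_mul (by omega)).2 ?_), ?_, ?_⟩
    · rw [Nat.succ_eq_add_one, mul_comm]
      omega
    · have := Nat.mul_le_mul_left ((p - 1) / N) (by omega : 2 ≤ N)
      omega
    · rw [mul_add_one, mul_comm]
      omega
  obtain ⟨I, hI, hIne, hIκ⟩ := IsPlacement.exists_indep (S := S) (f := f) q
    (fun i => (Nat.succ_le_succ hκt).trans (hpiece i)) hκ
  obtain ⟨T, hTq, hT⟩ := exists_subset_card_eq ((Nat.le_succ t).trans (hpiece q))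
  have hST : Disjoint S T := disjoint_right.2 fun v hv => (mem_piece.1 (hTq hv)).1
  have hP : IsPlacement S f q (S ∪ T) I :=
    ⟨fun v hv hvS => (mem_piece.1 (hTq ((mem_union.1 hv).resolve_left hvS))).2, hIne⟩
  have hA : #(S ∪ T) = d := by rw [card_union_of_disjoint hST, hT, hSd]
  have hAS : #((S ∪ T) \ S) = t := by rw [union_sdiff_cancel_left hST, hT]
  refine hP.false_of_card_sdiff_pos hS hG h hη hV hpm hp (fun i => hq.2 i (mem_univ i))
    subset_union_left hA hI (by rwa [hAS]) hIκ (by rwa [hAS]) hκp ?_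
  have hmass := card_nsmul_le_sum (univ.erase q) _ _ fun i _ => hpiece i
  have hcount := hP.sum_erase_card_piece
  have := hP.card_compl_sdiff_add
  rw [card_erase_of_mem (mem_univ q), card_univ, ← hNdef, smul_eq_mul] at hmass
  rw [sdiff_eq_empty_iff_subset.2 subset_union_left, card_empty, hA, hI, hV] at this
  rw [hI] at hcount
  rw [hAS]
  omega

end SmallSeparator

section LargeSeparator

theorem nonempty_iso_joinCliqueIndep_of_adj_iff {V : Type*} [Fintype V] {G : SimpleGraph V}
    {d m p : ℕ} {A B : Finset V} (hAB : Disjoint A B) (hA : #A = d) (hB : #B = m)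
    (hV : Fintype.card V = d + m + p)
    (hadj : ∀ u v, G.Adj u v ↔ u ≠ v ∧ (u ∈ A ∨ v ∈ A ∨ u ∈ B ∧ v ∈ B)) :
    Nonempty (G ≃g joinCliqueIndep d m p) := by
  classical
  have hC : #(A ∪ B)ᶜ = p := by
    rw [card_compl, card_union_of_disjoint hAB, hA, hB, hV, Nat.add_sub_cancel_left]
  let eA := (equivFinOfCardEq hA).symm
  let eB := (equivFinOfCardEq hB).symm
  let eC := (equivFinOfCardEq hC).symm
  have hC' (i : Fin p) : (eC i : V) ∉ A ∧ (eC i : V) ∉ B := by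
    simpa only [mem_compl, mem_union, not_or] using (eC i).2
  let g : Fin d ⊕ (Fin m ⊕ Fin p) → V :=
    Sum.elim (fun i => eA i) (Sum.elim (fun i => eB i) fun i => eC i)
  have hgA (x) : g (.inr x) ∉ A := by
    rcases x with i | i
    exacts [disjoint_right.1 hAB (eB i).2, (hC' i).1]
  have hgB (x) : g (.inr x) ∈ B ↔ x.isLeft := by
    rcases x with i | i
    exacts [iff_of_true (eB i).2 rfl, iff_of_false (hC' i).2 Bool.false_ne_true]
  have hg : g.Injective := by
    refine (Subtype.val_injective.comp eA.injective).sumElim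
      ((Subtype.val_injective.comp eB.injective).sumElim
        (Subtype.val_injective.comp eC.injective) fun i j hij => ?_) fun i x hij => ?_
    · exact (hC' j).2 (hij ▸ (eB i).2)
    · exact hgA x ((show (eA i : V) = g (.inr x) from hij) ▸ (eA i).2)
  have hbij : g.Bijective := (Fintype.bijective_iff_injective_and_card g).2
    ⟨hg, by simp only [Fintype.card_sum, Fintype.card_fin, hV, add_assoc]⟩
  refine ⟨(RelIso.mk (Equiv.ofBijective g hbij) fun {x y} => ?_ : joinCliqueIndep d m p ≃g G).symm⟩
  rw [Equiv.ofBijective_apply, Equiv.ofBijective_apply, hadj, hg.ne_iff]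
  rcases x with i | x
  · rw [joinCliqueIndep_adj_inl, ne_comm]
    exact and_iff_left (.inl (eA i).2)
  rcases y with j | y
  · rw [SimpleGraph.adj_comm, joinCliqueIndep_adj_inl]
    exact and_iff_left (.inr (.inl (eA j).2))
  · rw [joinCliqueIndep_adj_inr, Sum.inr_injective.ne_iff, hgB, hgB]
    simp only [hgA, false_or]

theorem seven_mul_le_of_card_bound {d m p t u N L : ℝ} (hd : 0 ≤ d) (hp : 2 ≤ p) (ht : 0 ≤ t)
    (hdm : 13 * d ≤ m) (hpm : 13 * p ≤ m) (hu : u ≤ m / 8 + 81 / 32 * p)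
    (hL : L = m + p - t) (hN : p + t + 1 ≤ N) (hNL : N ≤ L)
    (h : 8 * ((N - 1) * (2 * L - N)) ≤ (d + t) * L + 2 * u * (d + t + 4 * L)) : 7 * t ≤ m := by
  subst hL
  by_contra! hlt
  have : 2 * t ≤ m := by linarith
  have hmono : (p + t) * (2 * m + p - 3 * t - 1) ≤ (N - 1) * (2 * (m + p - t) - N) := by
    nlinarith [mul_nonneg (sub_nonneg.2 hN) (by linarith : 0 ≤ 2 * m + p - 3 * t - N)]
  have hone : (p + t) * (2 * m + p - 3 * t - m / 26) ≤ (p + t) * (2 * m + p - 3 * t - 1) := by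
    gcongr
    linarith
  have hdL : (d + t) * (m + p - t) ≤ (m / 13 + t) * (m + p - t) := by
    gcongr <;> linarith
  have huL : u * (d + t + 4 * (m + p - t)) ≤
      (m / 8 + 81 / 32 * p) * (m / 13 + t + 4 * (m + p - t)) := by
    gcongr <;> linarith
  nlinarith [mul_nonneg (by linarith : 0 ≤ 7 * t - m) (by linarith : 0 ≤ m - 2 * t),
    mul_nonneg (by linarith : 0 ≤ p) (by linarith : 0 ≤ m - 13 * p),
    mul_nonneg (by linarith : 0 ≤ p) (by linarith : 0 ≤ m - 2 * t),
    mul_nonneg (by linarith : 0 ≤ p) (by linarith : 0 ≤ 7 * t - m),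
    mul_nonneg (by linarith : 0 ≤ m) (by linarith : 0 ≤ m - 13 * p)]

theorem eq_zero_of_spread_le {m p t B R W : ℝ} (hm : 0 < m)
    (hpW : p * W ≤ 21 / 10 * m) (hW0 : 0 ≤ W) (hp : 2 ≤ p) (ht : 0 ≤ t) (htm : 7 * t ≤ m)
    (hB : R + t ≤ B) (hR : 0 ≤ R)
    (h₁ : 2 * (B * (m - t)) ≤ W * (p * t + R))
    (h₂ : 4 * (B * (m - t - B)) ≤ W * (p * t + R)) : B = 0 := by
  have hW : W * (p * t + R) ≤ 21 / 20 * m * (t + B) := by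
    have hWm : W ≤ 21 / 20 * m := by nlinarith
    have := mul_le_mul_of_nonneg_right hpW ht
    have := mul_le_mul_of_nonneg_right hWm hR
    have := mul_le_mul_of_nonneg_left hB hm.le
    linarith
  have hB0 : 0 ≤ B := by linarith
  by_contra hne
  have hpos : 0 < B * m := mul_pos (hB0.lt_of_ne' hne) hm
  have htB := mul_le_mul_of_nonneg_left htm hB0
  rcases le_total (2 * t) B with hlarge | hsmall
  · have := mul_le_mul_of_nonneg_left hlarge hm.le
    linarith
  · have htB' : m * t ≤ m * B := mul_le_mul_of_nonneg_left (by linarith) hm.le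
    have := mul_le_mul_of_nonneg_left hsmall hB0
    linarith

variable {V ι : Type*} [Fintype V] [DecidableEq V] [Fintype ι] [DecidableEq ι]
  {G : SimpleGraph V} {S A I : Finset V} {f : V → ι} {q : ι} {d m p : ℕ} {a r y : ℝ}

theorem IsSeparation.mul_le_sq_sub_sum_card_piece_sq (hS : IsSeparation G S f) :
    ((Fintype.card ι : ℝ) - 1) * (2 * #Sᶜ - Fintype.card ι) ≤
      #Sᶜ ^ 2 - ∑ i, (#(piece S f i) : ℝ) ^ 2 := by
  have hsq := sum_sq_le_sq_sum_of_nonneg (s := univ) (f := fun i => (#(piece S f i) : ℝ) - 1)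
    fun i _ => sub_nonneg.2 (Nat.one_le_cast.2 (card_pos.2 (hS.piece_nonempty i)))
  simp only [sub_sq, sum_add_distrib, sum_sub_distrib, ← mul_sum, ← sum_mul, sum_const, card_univ,
    nsmul_eq_mul, ← Nat.cast_sum, sum_card_piece] at hsq
  linarith

omit [DecidableEq ι] in
/-- Rayleigh's principle for the vector with value `1` on `S` and `2` elsewhere. -/
theorem IsSeparation.mul_le_of_distSignlessRadius_le (hS : IsSeparation G S f)
    (hG : G.Connected) {u : ℝ}
    (hη : distSignlessRadius G ≤ 2 * Fintype.card V - 2 + 2 * u) :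
    8 * (((Fintype.card ι : ℝ) - 1) * (2 * #Sᶜ - Fintype.card ι)) ≤
      #S * #Sᶜ + 2 * u * (#S + 4 * #Sᶜ) := by
  classical
  set x : V → ℝ := fun v => if v ∈ S then 1 else 2
  have hsum (g : ℝ → ℝ) : ∑ v, g (x v) = #S * g 1 + #Sᶜ * g 2 := by
    rw [← sum_add_sum_compl S, sum_congr rfl fun v hv => congrArg g (if_pos hv),
      sum_congr (s₁ := Sᶜ) rfl fun v hv => congrArg g (if_neg (mem_compl.1 hv)), sum_const,
      sum_const, nsmul_eq_mul, nsmul_eq_mul]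
  have hV : (Fintype.card V : ℝ) = #S + #Sᶜ := mod_cast S.card_add_card_compl.symm
  have hcompl : ∀ v ∈ Sᶜ, x v = 2 := fun v hv => if_neg (mem_compl.1 hv)
  have hform : sepForm S f x = 8 * (#Sᶜ ^ 2 - ∑ i, (#(piece S f i) : ℝ) ^ 2) := by
    rw [sepForm, pairForm_of_forall_eq hcompl, sum_congr rfl fun i _ =>
      pairForm_of_forall_eq fun v hv => hcompl v (mem_compl.2 (mem_piece.1 hv).1), ← mul_sum]
    ring
  have hray := hS.rayleigh hG x
  have hle := mul_le_mul_of_nonneg_right hη (sum_nonneg fun v (_ : v ∈ univ) => sq_nonneg (x v))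
  rw [hform, pairForm, hsum fun z => z, card_univ] at hray
  rw [hsum fun z => z ^ 2, hV] at hray hle
  linarith [hS.mul_le_sq_sub_sum_card_piece_sq]

omit [DecidableEq ι] in
theorem IsSeparation.seven_mul_card_sub_le (hS : IsSeparation G S f) (hG : G.Connected)
    (h : IsPerronTriple d m p a r y) (hη : distSignlessRadius G ≤ y)
    (hV : Fintype.card V = d + m + p) (hdm : 13 * d ≤ m) (hpm : 13 * p ≤ m) (hp : 2 ≤ p)
    (hdS : d ≤ #S) (hN : p + #S + 1 ≤ Fintype.card ι + d) : 7 * (#S - d) ≤ m := by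
  classical
  obtain ⟨t, ht⟩ := Nat.exists_eq_add_of_le hdS
  have hL : #Sᶜ + t = m + p := by
    have := S.card_add_card_compl
    omega
  have hNL : Fintype.card ι ≤ #Sᶜ := by
    rw [← sum_card_piece S f, ← card_univ, card_eq_sum_ones]
    exact sum_le_sum fun i _ => card_pos.2 (hS.piece_nonempty i)
  have hbound := hS.mul_le_of_distSignlessRadius_le hG (u := p * r) (by
    rw [hV]
    push_cast
    exact hη.trans h.y_le)
  rw [ht, Nat.add_sub_cancel_left]
  rw [ht, Nat.cast_add] at hbound
  have := seven_mul_le_of_card_bound (d := d) (m := m) (p := p) (t := t) (Nat.cast_nonneg _)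
    (mod_cast hp) (Nat.cast_nonneg _) (mod_cast hdm) (mod_cast hpm) h.mul_r_le
    (eq_sub_of_add_eq (mod_cast hL)) (by norm_cast; omega) (Nat.cast_le.2 hNL) hbound
  exact_mod_cast this

theorem IsPlacement.card_add_sum_mul_le (hP : IsPlacement S f q A I) (hS : IsSeparation G S f)
    (hI : ∀ i, #(piece S f i ∩ I) ≤ 1) :
    Fintype.card ι + ∑ i, #(piece S f i ∩ I) * #(piece S f i \ (A ∪ I)) +
      #(piece S f q \ (A ∪ I)) ≤ #(Sᶜ \ (A ∪ I)) + #I + 1 := by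
  have hmass : ∑ i ∈ univ.erase q, (1 + #(piece S f i ∩ I) * #(piece S f i \ (A ∪ I))) ≤
      ∑ i ∈ univ.erase q, #(piece S f i) := sum_le_sum fun i hi => by
    have hpos := card_pos.2 (hS.piece_nonempty i)
    have hsplit := hP.card_piece_of_ne (ne_of_mem_erase hi)
    rcases Nat.le_one_iff_eq_zero_or_eq_one.1 (hI i) with h | h <;> rw [h] at hsplit ⊢ <;> omega
  have hcount := hP.sum_erase_card_piece
  rw [sum_add_distrib, sum_const, card_erase_of_mem (mem_univ q), card_univ, smul_eq_mul,
    mul_one, sum_erase _ (by rw [hP.piece_inter_indep_self, card_empty, zero_mul])] at hmass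
  omega

theorem IsPlacement.eq_of_distSignlessRadius_le (hP : IsPlacement S f q A I)
    (hS : IsSeparation G S f) (hG : G.Connected) (h : IsPerronTriple d m p a r y)
    (hη : distSignlessRadius G ≤ y) (hV : Fintype.card V = d + m + p) (hpm : 13 * p ≤ m)
    (hp : 2 ≤ p) (hq : ∀ i, #(piece S f i) ≤ #(piece S f q)) (hAS : A ⊆ S) (hA : #A = d)
    (hI : #I = p) (hI₁ : ∀ i, #(piece S f i ∩ I) ≤ 1) (ht : 7 * #(S \ A) ≤ m)
    (hN : p + #(S \ A) + 1 ≤ Fintype.card ι) :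
    A = S ∧ #(piece S f q \ (A ∪ I)) = m := by
  have hAS' : #(A \ S) = 0 := by rw [sdiff_eq_empty_iff_subset.2 hAS, card_empty]
  have hm : #(Sᶜ \ (A ∪ I)) + #(S \ A) = m := by
    have := hP.card_compl_sdiff_add
    omega
  have hloose := hP.card_add_sum_mul_le hS hI₁
  have hle := hP.sepForm_le_extremalForm hS hG h hη hV hA hI
  have hM : (#(Sᶜ \ (A ∪ I)) : ℝ) + #(S \ A) = m := mod_cast hm
  have hform := hP.le_sepForm (κ := 0) (fun i => by rw [zero_add]; exact_mod_cast hI₁ i) hM a r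
  have hspread := hP.mul_le_card_sq_sub_sum_card_sq hq
  have hspread' := two_mul_mul_le_card_sq_sub_sum_card_sq S A I f q
  rw [hAS', Nat.cast_zero] at hform hspread
  rw [hI] at hform
  have hgap : ∑ i, #(piece S f i ∩ I) * #(piece S f i \ (A ∪ I)) + #(S \ A) +
      #(piece S f q \ (A ∪ I)) ≤ #(Sᶜ \ (A ∪ I)) := by omega
  rw [← Nat.cast_le (α := ℝ)] at hgap
  simp only [Nat.cast_add, Nat.cast_sum, Nat.cast_mul] at hgap
  have hB := eq_zero_of_spread_le (m := m) (p := p) (t := #(S \ A)) (W := (1 + r) ^ 2)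
    (B := #(Sᶜ \ (A ∪ I)) - #(piece S f q \ (A ∪ I)))
    (R := ∑ i, (#(piece S f i ∩ I) : ℝ) * #(piece S f i \ (A ∪ I)))
    (by linarith [h.one_le_m]) (h.mul_one_add_r_sq_le (mod_cast hpm)) (sq_nonneg _)
    (mod_cast hp) (Nat.cast_nonneg _) (mod_cast ht)
    (le_sub_iff_add_le.2 hgap)
    (sum_nonneg fun i _ => mul_nonneg (Nat.cast_nonneg _) (Nat.cast_nonneg _))
    (by rw [← hM, add_sub_cancel_right]; linarith) (by rw [← hM, add_sub_cancel_right]; linarith)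
  have hB' : #(Sᶜ \ (A ∪ I)) = #(piece S f q \ (A ∪ I)) := Nat.cast_injective (sub_eq_zero.1 hB)
  have hSA : #(S \ A) = 0 := by omega
  exact ⟨hAS.antisymm (sdiff_eq_empty_iff_subset.1 (card_eq_zero.1 hSA)), by omega⟩

omit [Fintype ι] in
theorem IsPlacement.adj_of_card_eq [Finite ι] (hP : IsPlacement S f q S I)
    (hS : IsSeparation G S f) (hG : G.Connected) (h : IsPerronTriple d m p a r y)
    (hη : distSignlessRadius G ≤ y) (hV : Fintype.card V = d + m + p) (hSd : #S = d)
    (hI : #I = p) (hI₁ : ∀ i, #(piece S f i ∩ I) ≤ 1) (hq : #(piece S f q \ (S ∪ I)) = m)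
    {u v : V} (huv : u ≠ v) (hsep : u ∈ S ∨ v ∈ S ∨ f u = f v) : G.Adj u v := by
  have := Fintype.ofFinite ι
  have hm : #(Sᶜ \ (S ∪ I)) = m := by
    have := hP.card_compl_sdiff_add
    rw [sdiff_self, bot_eq_empty, card_empty] at this
    omega
  have hI₁' (i : ι) : (#(piece S f i ∩ I) : ℝ) ≤ 0 + 1 := by
    rw [zero_add]
    exact_mod_cast hI₁ i
  have hform := hP.le_sepForm hI₁' (by rw [hm, add_zero]) a r
  have hspread := two_mul_mul_le_card_sq_sub_sum_card_sq S S I f q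
  have hcross := mul_le_mul_of_nonneg_left (hP.sum_card_mul_card_le hI₁') (sq_nonneg (1 + r))
  rw [hm, hq] at hspread hcross
  rw [hm, hq, hI, sdiff_self, bot_eq_empty, card_empty, Nat.cast_zero] at hform
  exact hP.adj_of_extremalForm_le hS hG h hη hV hSd hI (by linarith) huv hsep

omit [DecidableEq ι] in
theorem IsSeparation.nonempty_iso_joinCliqueIndep [Nonempty ι] (hS : IsSeparation G S f)
    (hG : G.Connected) (h : IsPerronTriple d m p a r y) (hη : distSignlessRadius G ≤ y)
    (hV : Fintype.card V = d + m + p) (hdm : 13 * d ≤ m) (hpm : 13 * p ≤ m) (hp : 2 ≤ p)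
    (hdS : d ≤ #S) (hN : p + #S + 1 ≤ Fintype.card ι + d) :
    Nonempty (G ≃g joinCliqueIndep d m p) := by
  classical
  obtain ⟨q, hq⟩ := exists_max_image univ (fun i => #(piece S f i)) univ_nonempty
  obtain ⟨A, hAS, hA⟩ := exists_subset_card_eq hdS
  obtain ⟨I, hI, hIne, hI₁⟩ := IsPlacement.exists_indep (S := S) (f := f) (κ := 0) (p := p) q
    (fun i => card_pos.2 (hS.piece_nonempty i)) (by omega)
  have hP : IsPlacement S f q A I := ⟨fun v hv hvS => absurd (hAS hv) hvS, hIne⟩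
  have hSA : #(S \ A) = #S - d := by rw [card_sdiff_of_subset hAS, hA]
  obtain ⟨rfl, hm⟩ := hP.eq_of_distSignlessRadius_le hS hG h hη hV hpm hp
    (fun i => hq.2 i (mem_univ i)) hAS hA hI hI₁
    (by rw [hSA]; exact hS.seven_mul_card_sub_le hG h hη hV hdm hpm hp hdS hN) (by omega)
  have hq_card : #(piece A f q) = m := by
    rw [← hP.card_piece_self, sdiff_self, bot_eq_empty, card_empty, zero_add, hm]
  have hloose {v : V} (hv : v ∉ A) (hvq : f v ≠ q) : v ∈ I := by
    have hsub : piece A f q \ (A ∪ I) ⊆ Aᶜ \ (A ∪ I) :=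
      sdiff_subset_sdiff (filter_subset _ _) subset_rfl
    have hcard := hP.card_compl_sdiff_add
    rw [sdiff_self, bot_eq_empty, card_empty] at hcard
    have hall := eq_of_subset_of_card_le hsub (by omega)
    by_contra hvI
    have hv : v ∈ Aᶜ \ (A ∪ I) := by simp [hv, hvI]
    rw [← hall, mem_sdiff, mem_piece] at hv
    exact hvq hv.1.2
  have hadj {u v : V} := hP.adj_of_card_eq hS hG h hη hV hA hI hI₁ hm (u := u) (v := v)
  refine nonempty_iso_joinCliqueIndep_of_adj_iff (A := A) (B := piece A f q)
    (disjoint_right.2 fun v hv => (mem_piece.1 hv).1) hA hq_card hV fun u v =>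
      ⟨fun huv => ⟨huv.ne, ?_⟩, fun ⟨huv, hsep⟩ => hadj huv ?_⟩
  · by_contra! hne
    have hf := hS.eq_of_adj hne.1 hne.2.1 huv
    have hfq : f v ≠ q := fun h =>
      hne.2.2 (mem_piece.2 ⟨hne.1, hf.trans h⟩) (mem_piece.2 ⟨hne.2.1, h⟩)
    exact huv.ne (card_le_one.1 (hI₁ (f v)) u
      (mem_inter.2 ⟨mem_piece.2 ⟨hne.1, hf⟩, hloose hne.1 (hf.trans_ne hfq)⟩) v
      (mem_inter.2 ⟨mem_piece.2 ⟨hne.2.1, rfl⟩, hloose hne.2.1 hfq⟩))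
  · exact hsep.imp_right (Or.imp_right fun h =>
      (mem_piece.1 h.1).2.trans (mem_piece.1 h.2).2.symm)

end LargeSeparator

theorem IsSeparation.nonempty_iso_of_le_minDegree {V ι : Type*} [Fintype V] [DecidableEq V]
    [Fintype ι] [Nonempty ι] {G : SimpleGraph V} [DecidableRel G.Adj]
    {S : Finset V} {f : V → ι} {b k d m p : ℕ} (hS : IsSeparation G S f) (hG : G.Connected)
    (hη : distSignlessRadius G ≤ distSignlessRadius (joinCliqueIndep d m p))
    (hV : Fintype.card V = d + m + p) (hdm : 13 * d ≤ m) (hpm : 13 * p ≤ m)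
    (hp : p = b * (d - k) + 1) (hb : 0 < b) (hkd : k < d) (hd : d ≤ G.minDegree) (hkS : k < #S)
    (hN : b * (#S - k) + 2 ≤ Fintype.card ι) : Nonempty (G ≃g joinCliqueIndep d m p) := by
  classical
  have hp₁ : 0 < b * (d - k) := Nat.mul_pos hb (Nat.sub_pos_of_lt hkd)
  have hS₁ : 0 < b * (#S - k) := Nat.mul_pos hb (Nat.sub_pos_of_lt hkS)
  obtain ⟨a, r, h⟩ := exists_isPerronTriple (s := d) (m := m) (t := p)
    (by omega) (by omega) (by omega)
  rcases le_or_gt d #S with hdS | hSd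
  · refine hS.nonempty_iso_joinCliqueIndep hG h hη hV hdm hpm (by omega) hdS ?_
    have hsplit : b * (#S - k) = b * (d - k) + b * (#S - d) := by
      rw [← mul_add]
      congr 1
      omega
    have := Nat.le_mul_of_pos_left (#S - d) hb
    omega
  · obtain ⟨t, rfl⟩ := Nat.exists_eq_add_of_le hSd.le
    have hsplit : b * (#S + t - k) = b * (#S - k) + b * t := by
      rw [← mul_add]
      congr 1
      omega
    have ht : 0 < t := by omega
    have hbt : 0 < b * t := Nat.mul_pos hb ht
    refine (hS.false_of_card_lt hG h hη hV hpm (by omega) ht rfl (fun i => ?_) (by omega) ?_).elim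
    · have := hS.minDegree_lt_card_add_card_piece i
      omega
    · have hle : (b * (#S - k) + 1) * (t + 1) ≤ (Fintype.card ι - 1) * (t + 1) :=
        Nat.mul_le_mul_right _ (by omega)
      have hprod : b * t ≤ b * (#S - k) * t :=
        Nat.mul_le_mul_right _ (Nat.le_mul_of_pos_right b (by omega))
      linarith

theorem theorem1p6_general (b k δ : ℕ) (hb : Odd b) (hk : 0 < k)
    {V : Type*} [Fintype V] [DecidableEq V] (G : SimpleGraph V) [DecidableRel G.Adj]
    (hV : Fintype.card V ≡ k [MOD 2]) (hconn : IsKConnected G (k + 1)) (hkδ : k < δ)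
    (hδ : δ ≤ G.minDegree) (hbound : 15 * (b * δ) ≤ Fintype.card V)
    (hη : distSignlessRadius G ≤ distSignlessRadius (extremalGraph (Fintype.card V) b k δ)) :
    IsKCriticalOddFactor G k b ∨ Nonempty (G ≃g extremalGraph (Fintype.card V) b k δ) := by
  refine or_iff_not_imp_left.2 fun hcrit => ?_
  obtain ⟨S, N, f, hS, hkS, hN⟩ :=
    exists_isSeparation_of_not_isKCriticalOddFactor hb hV hconn hcrit
  have : Nonempty (Fin N) := ⟨0, by omega⟩
  have hbk : 0 < b * k := Nat.mul_pos hb.pos hk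
  have hbkδ : b * k ≤ b * δ := Nat.mul_le_mul_left b hkδ.le
  have hδb : δ ≤ b * δ := Nat.le_mul_of_pos_left δ hb.pos
  have hsucc : (b + 1) * δ = b * δ + δ := Nat.add_one_mul b δ
  exact hS.nonempty_iso_of_le_minDegree hconn.connected hη (by omega) (by omega) (by omega)
    (by rw [Nat.mul_sub]) hb.pos hkδ hδ hkS (by rwa [Fintype.card_fin])

theorem fifteen_mul_le_of_bound {b k δ n : ℕ} (hb : 0 < b) (hk : 0 < k) (hkδ : k < δ)
    (hbound : (2 * b ^ 2 + 4 * b) * δ ^ 2 + 2 * δ + 2 * b ^ 2 * k ^ 2 ≤ n) :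
    15 * (b * δ) ≤ n := by
  obtain ⟨c, rfl⟩ := Nat.exists_eq_add_of_le' (Nat.one_le_of_lt hb)
  obtain ⟨e, rfl⟩ := Nat.exists_eq_add_of_le' (by omega : 2 ≤ δ)
  have hk₂ : 2 * (c + 1) ^ 2 ≤ 2 * (c + 1) ^ 2 * k ^ 2 :=
    Nat.le_mul_of_pos_right _ (Nat.pow_pos hk)
  have hexpand : (2 * (c + 1) ^ 2 + 4 * (c + 1)) * (e + 2) ^ 2 + 2 * (e + 2) + 2 * (c + 1) ^ 2 =
      15 * ((c + 1) * (e + 2)) +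
        (2 * c ^ 2 * (e ^ 2 + 4 * e + 5) + c * (8 * e ^ 2 + 17 * e + 6) + e * (6 * e + 11)) := by
    ring
  omega

theorem theorem1p6 (b k n δ : ℕ) (hb : 0 < b) (hk : 0 < k) (hn : 0 < n)
    (hnk : n ≡ k [MOD 2]) (hb_odd : b ≡ 1 [MOD 2]) (hkb : k ≤ b)
    {V : Type*} [Fintype V] [DecidableEq V] (G : SimpleGraph V) [DecidableRel G.Adj]
    (hcard : Fintype.card V = n) (hconn : IsKConnected G (k + 1)) (hδ : G.minDegree = δ)
    (hbound : max ((2 * (b : ℝ) ^ 2 + 4 * b) * (δ : ℝ) ^ 2 + 2 * δ + 2 * (b : ℝ) ^ 2 * (k : ℝ) ^ 2)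
      (6 / 5 * (b : ℝ) ^ 2 * (δ : ℝ) ^ 3 + 8 / 5 * (b : ℝ) ^ 2 * k * (δ : ℝ) ^ 2) ≤ (n : ℝ))
    (hη : distSignlessRadius G ≤ distSignlessRadius (extremalGraph n b k δ)) :
    IsKCriticalOddFactor G k b ∨ Nonempty (G ≃g extremalGraph n b k δ) := by
  subst hcard hδ
  have hbound' := fifteen_mul_le_of_bound hb hk hconn.lt_minDegree
    (by exact_mod_cast (max_le_iff.1 hbound).1)
  exact theorem1p6_general b k G.minDegree (Nat.odd_iff.2 hb_odd) hk G hnk hconn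
    hconn.lt_minDegree le_rfl hbound' hη
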